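/- **Definitions.** Let $n\ge 0$. A *chord diagram* with $n+1$ chords is a set of $n+1$ disjoint properly embedded arcs in a disc $D$, up to homotopy relative to endpoints, with $2n+2$ marked endpoints on $\partial D$ numbered $0,1,\dots,2n+1$ clockwise (mod $2n+2$); $0$ is the base point. Its regions are signed alternately, the one immediately clockwise of the base point being positive, and its *relative euler class* $e$ is the sum of the signs of the regions. Three chord diagrams form a *bypass triple* if they agree outside a sub-disc that each of them meets in three arcs, and inside the sub-disc they are obtained from one another by rotations by $60^\circ$: if $a_1,\dots,a_6$ are the six points on the boundary of the sub-disc in cyclic order, the three diagrams join them as $(a_1a_2)(a_3a_6)(a_4a_5)$, $(a_2a_3)(a_1a_4)(a_5a_6)$ and $(a_3a_4)(a_2a_5)(a_6a_1)$. Let $SFH(T,n+1)$ be the $\mathbb Z_2$-vector space generated by the chord diagrams with $n+1$ chords, modulo $\Gamma_1+\Gamma_2+\Gamma_3=0$ for every bypass triple. For a word $w$ of length $n$ in the symbols $-,+$, the *basis chord diagram* $\Gamma_w$ with $n+1$ chords is defined recursively: for the empty word it is the diagram with one chord; $\Gamma_{\pm w'}$ is obtained from $\Gamma_{w'}$ by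 adding an outermost chord which encloses a region of sign $\pm$ and joins the new base point to the next marked point clockwise (for $+$) or anticlockwise (for $-$), the base point of $\Gamma_{w'}$ being the marked point that follows the new chord in that direction. Write $w_0\preceq w_1$ if $w_0$ and $w_1$ have equally many minus signs and, for each $i$, the $i$-th minus sign of $w_0$ is to the left of, or in the same position as, the $i$-th minus sign of $w_1$. For chord diagrams $\Gamma_0,\Gamma_1$ with $n+1$ chords, take the cylinder $D\times[0,1]$ with $\Gamma_0$ on $D\times\{0\}$, $\Gamma_1$ on $D\times\{1\}$, and vertical sutures on $\partial D\times[0,1]$ between successive marked points. Rounding the corners joins the marked point $i$ of $D\times\{0\}$ to the marked point $i-1$ of $D\times\{1\}$, for all $i$ mod $2n+2$. $\Gamma_1$ is *stackable* on $\Gamma_0$ if the sutured cylinder is tight, i.e. if the resulting collection of closed curves on the sphere consists of a single curve. **Proposition (General stackability).** Every chord diagram $\Gamma$ with $n+1$ chords has a unique basis decomposition, i.e. there is exactly one set $S$ of words of length $n$ with $\Gamma=\sum_{w\in S}\Gamma_w$ in $SFH(T,n+1)$; say that $\Gamma_w$ *occurs* in it if $w\in S$. Let $\Gamma_0,\Gamma_1$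 be chord diagrams with $n+1$ chords and relative euler class $e$. Then $\Gamma_1$ is stackable on $\Gamma_0$ if and only if the cardinality of $$\{(w_0,w_1) : w_0\preceq w_1,\ \Gamma_{w_i}\text{ occurs in the basis decomposition of }\Gamma_i\ (i=0,1)\}$$ is odd. -/

import Mathlib

/-- A chord diagram of `n` chords, up to homotopy relative to endpoints: a non-crossing perfect
matching of `2 * n` marked points on the boundary of the disc.  The marked points are numbered
`0, 1, …, 2 * n - 1` clockwise, and `0` is the base point. -/
@[ext]
structure ChordDiagram (n : ℕ) where
  /-- the other endpoint of the chord that ends at a given marked point -/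
  partner : Fin (2 * n) → Fin (2 * n)
  partner_partner : ∀ i, partner (partner i) = i
  partner_ne : ∀ i, partner i ≠ i
  noncrossing : ∀ i j, ¬ (i < j ∧ j < partner i ∧ partner i < partner j)

namespace ChordDiagram

/-- The boundary arc `i` runs clockwise from the marked point `i` to the next one.  Two boundary
arcs lie on the same region of the complement of the chords iff no chord separates them; the chord
from `a` to `partner a`, where `a < partner a`, separates the arcs `i` with `a ≤ i < partner a`
from all others. -/
def sameRegion {n : ℕ} (Γ : ChordDiagram n) : Setoid (Fin (2 * n)) where
  r i j := ∀ a, (a ≤ i ∧ i < Γ.partner a) ↔ (a ≤ j ∧ j < Γ.partner a)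
  iseqv := ⟨fun _ _ => Iff.rfl, fun h a => (h a).symm, fun h h' a => (h a).trans (h' a)⟩

/-- The regions into which the chords cut the disc (each of them meets the boundary). -/
def Region {n : ℕ} (Γ : ChordDiagram n) : Type := Quotient Γ.sameRegion

/-- A region is positive if it contains an even boundary arc: signs alternate around the boundary,
and the arc immediately clockwise of the base point, arc `0`, is positive. -/
def Region.IsPositive {n : ℕ} {Γ : ChordDiagram n} (R : Γ.Region) : Prop :=
  ∃ i : Fin (2 * n), Even (i : ℕ) ∧ Quotient.mk Γ.sameRegion i = R

/-- A region is negative if it contains an odd boundary arc. -/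
def Region.IsNegative {n : ℕ} {Γ : ChordDiagram n} (R : Γ.Region) : Prop :=
  ∃ i : Fin (2 * n), Odd (i : ℕ) ∧ Quotient.mk Γ.sameRegion i = R

/-- The (relative) euler class: the sum of the signs of the regions. -/
noncomputable def eulerClass {n : ℕ} (Γ : ChordDiagram n) : ℤ :=
  ({R : Γ.Region | R.IsPositive}.ncard : ℤ) - ({R : Γ.Region | R.IsNegative}.ncard : ℤ)

/-! ### The vector space generated by chord diagrams -/

/-- The three chord diagrams agree except on the six marked points `a 0, …, a 5`, listed in
clockwise order, which are the ends of the three chords that run through the sub-disc of a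
bypass move; inside the sub-disc the three arrangements differ by rotations by 60 degrees.
Numbering the six points from another one of them only permutes the three diagrams cyclically.
(If an attaching arc meets the same chord twice, then of its two bypass moves one produces a closed
loop and the other changes nothing, so that the relation reads `x + x + 0 = 0`, which is no
condition modulo 2.) -/
def IsBypassTriple {n : ℕ} (Γ₁ Γ₂ Γ₃ : ChordDiagram n) : Prop :=
  ∃ a : Fin 6 → Fin (2 * n), StrictMono a ∧
    (Γ₁.partner (a 0) = a 1 ∧ Γ₁.partner (a 2) = a 5 ∧ Γ₁.partner (a 3) = a 4) ∧
    (Γ₂.partner (a 1) = a 2 ∧ Γ₂.partner (a 0) = a 3 ∧ Γ₂.partner (a 4) = a 5) ∧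
    (Γ₃.partner (a 2) = a 3 ∧ Γ₃.partner (a 1) = a 4 ∧ Γ₃.partner (a 5) = a 0) ∧
    ∀ i, (∀ k, i ≠ a k) → Γ₁.partner i = Γ₂.partner i ∧ Γ₂.partner i = Γ₃.partner i

/-- The subspace spanned by the bypass relations. -/
noncomputable def bypassRelations (n : ℕ) : Submodule (ZMod 2) (ChordDiagram n →₀ ZMod 2) :=
  Submodule.span (ZMod 2)
    {x | ∃ Γ₁ Γ₂ Γ₃ : ChordDiagram n, IsBypassTriple Γ₁ Γ₂ Γ₃ ∧
      x = Finsupp.single Γ₁ 1 + Finsupp.single Γ₂ 1 + Finsupp.single Γ₃ 1}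

/-- The combinatorial sutured Floer homology `SFH(T, n)`: the vector space over `ℤ/2` generated by
the chord diagrams of `n` chords, subject to the bypass relations. -/
abbrev SFH (n : ℕ) : Type := (ChordDiagram n →₀ ZMod 2) ⧸ bypassRelations n

/-- The class of a chord diagram in `SFH(T, n)`. -/
noncomputable def toSFH {n : ℕ} (Γ : ChordDiagram n) : SFH n :=
  (bypassRelations n).mkQ (Finsupp.single Γ 1)

/-! ### Basis chord diagrams -/

/-- The unique chord diagram with one chord. -/
def vacuum : ChordDiagram 1 where
  partner i := ⟨1 - (i : ℕ), by omega⟩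
  partner_partner i := by ext; simp only; omega
  partner_ne i h := by have := congrArg Fin.val h; simp only at this; omega
  noncrossing i j := by simp only [Fin.lt_def]; omega

/-- The creation operator `B₊`: add an outermost chord from the base point `0` to the next marked
point clockwise, `1`.  The marked point `i` of `Γ` becomes `i + 2`. -/
def createPlus {n : ℕ} (Γ : ChordDiagram n) : ChordDiagram (n + 1) where
  partner k :=
    if h : (k : ℕ) < 2 then ⟨1 - (k : ℕ), by omega⟩
    else ⟨(Γ.partner ⟨(k : ℕ) - 2, by omega⟩ : ℕ) + 2, by omega⟩
  partner_partner k := by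
    by_cases h : (k : ℕ) < 2
    · have h' : 1 - (k : ℕ) < 2 := by omega
      ext; simp only [h, h', dif_pos]; omega
    · ext; simp [h, Γ.partner_partner]; omega
  partner_ne k hk := by
    have hk := congrArg Fin.val hk
    by_cases h : (k : ℕ) < 2
    · simp only [h, dif_pos] at hk; omega
    · simp only [h, dif_neg, not_false_eq_true] at hk
      exact Γ.partner_ne ⟨(k : ℕ) - 2, by omega⟩ (by ext; simp only; omega)
  noncrossing i j := by
    rintro ⟨h₁, h₂, h₃⟩
    simp only [Fin.lt_def] at h₁ h₂ h₃
    by_cases hi : (i : ℕ) < 2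
    · simp only [hi, dif_pos] at h₂; omega
    · have hj : ¬ (j : ℕ) < 2 := by omega
      simp only [hi, hj, dif_neg, not_false_eq_true] at h₂ h₃
      refine Γ.noncrossing ⟨(i : ℕ) - 2, by omega⟩ ⟨(j : ℕ) - 2, by omega⟩ ⟨?_, ?_, ?_⟩ <;>
        simp only [Fin.lt_def] <;> omega

/-- The new number, in `createMinus`, of the marked point `j`: the base point becomes `2 * n` and
every other marked point keeps its number. -/
def minusEmb {n : ℕ} (j : Fin (2 * n)) : Fin (2 * (n + 1)) :=
  ⟨if (j : ℕ) = 0 then 2 * n else (j : ℕ), by split_ifs <;> omega⟩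

/-- The old number of a marked point `k` other than `0` and `2 * n + 1`; inverse to `minusEmb`. -/
def minusInv {n : ℕ} (k : Fin (2 * (n + 1))) (h : ¬ ((k : ℕ) = 0 ∨ (k : ℕ) = 2 * n + 1)) :
    Fin (2 * n) :=
  ⟨if (k : ℕ) = 2 * n then 0 else (k : ℕ), by split_ifs <;> omega⟩

theorem minusEmb_val {n : ℕ} (j : Fin (2 * n)) :
    ((j : ℕ) = 0 ∧ (minusEmb j : ℕ) = 2 * n) ∨ ((j : ℕ) ≠ 0 ∧ (minusEmb j : ℕ) = j) := by
  by_cases h : (j : ℕ) = 0 <;> simp [minusEmb, h]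

theorem minusInv_val {n : ℕ} (k : Fin (2 * (n + 1)))
    (h : ¬ ((k : ℕ) = 0 ∨ (k : ℕ) = 2 * n + 1)) :
    ((k : ℕ) = 2 * n ∧ (minusInv k h : ℕ) = 0) ∨
      ((k : ℕ) ≠ 2 * n ∧ (minusInv k h : ℕ) = k) := by
  by_cases h' : (k : ℕ) = 2 * n <;> simp [minusInv, h']

/-- The creation operator `B₋`: add an outermost chord from the base point `0` to the next marked
point anticlockwise, `2 * n + 1`.  The base point of `Γ` becomes `2 * n`, the next marked point
anticlockwise, and every other marked point of `Γ` keeps its number. -/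
def createMinus {n : ℕ} (Γ : ChordDiagram n) : ChordDiagram (n + 1) where
  partner k :=
    if h : (k : ℕ) = 0 ∨ (k : ℕ) = 2 * n + 1 then ⟨2 * n + 1 - (k : ℕ), by omega⟩
    else minusEmb (Γ.partner (minusInv k h))
  partner_partner k := by
    by_cases h : (k : ℕ) = 0 ∨ (k : ℕ) = 2 * n + 1
    · have h' : 2 * n + 1 - (k : ℕ) = 0 ∨ 2 * n + 1 - (k : ℕ) = 2 * n + 1 := by omega
      ext; simp only [h, h', dif_pos]; omega
    · have e₁ := minusEmb_val (Γ.partner (minusInv k h))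
      have h' : ¬ ((minusEmb (Γ.partner (minusInv k h)) : ℕ) = 0 ∨
          (minusEmb (Γ.partner (minusInv k h)) : ℕ) = 2 * n + 1) := by omega
      have e₂ : minusInv _ h' = Γ.partner (minusInv k h) := by
        have := minusInv_val _ h'
        ext; omega
      simp only [h, h', dif_neg, not_false_eq_true, e₂, Γ.partner_partner]
      have e₃ := minusInv_val k h
      have e₄ := minusEmb_val (minusInv k h)
      ext; omega
  partner_ne k hk := by
    have hk := congrArg Fin.val hk
    by_cases h : (k : ℕ) = 0 ∨ (k : ℕ) = 2 * n + 1
    · simp only [h, dif_pos] at hk; omega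
    · simp only [h, dif_neg, not_false_eq_true] at hk
      have e₁ := minusEmb_val (Γ.partner (minusInv k h))
      have e₂ := minusInv_val k h
      exact Γ.partner_ne (minusInv k h) (by ext; omega)
  noncrossing i j := by
    rintro ⟨h₁, h₂, h₃⟩
    simp only [Fin.lt_def] at h₁ h₂ h₃
    by_cases hj : (j : ℕ) = 0 ∨ (j : ℕ) = 2 * n + 1
    · simp only [hj, dif_pos] at h₃; omega
    simp only [hj, dif_neg, not_false_eq_true] at h₃
    have e₁ := minusEmb_val (Γ.partner (minusInv j hj))
    by_cases hi : (i : ℕ) = 0 ∨ (i : ℕ) = 2 * n + 1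
    · simp only [hi, dif_pos] at h₂ h₃; omega
    simp only [hi, dif_neg, not_false_eq_true] at h₂ h₃
    have e₂ := minusEmb_val (Γ.partner (minusInv i hi))
    have e₃ := minusInv_val i hi
    have e₄ := minusInv_val j hj
    have c := Γ.noncrossing (minusInv i hi) (minusInv j hj)
    have c' := Γ.noncrossing (Γ.partner (minusInv j hj)) (minusInv i hi)
    simp only [Fin.lt_def, Γ.partner_partner] at c c'
    omega

/-- The basis chord diagram `Γ_w = B_{w 0} B_{w 1} ⋯ B_{w (n - 1)} (vacuum)` of a word `w` on the
symbols `-` (that is `false`) and `+` (that is `true`). -/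
def ofWord : {n : ℕ} → (Fin n → Bool) → ChordDiagram (n + 1)
  | 0, _ => vacuum
  | _ + 1, w => if w 0 then createPlus (ofWord (Fin.tail w)) else createMinus (ofWord (Fin.tail w))

/-- `Γ_w` occurs in the basis decomposition of `Γ`. -/
def Occurs {n : ℕ} (w : Fin n → Bool) (Γ : ChordDiagram (n + 1)) : Prop :=
  ∃ S : Finset (Fin n → Bool), Γ.toSFH = ∑ v ∈ S, (ofWord v).toSFH ∧ w ∈ S

/-! ### Stackability -/

/-- The arcs of the sutures on the sphere obtained from the boundary of the cylinder
`D × [0, 1]` with `Γ₀` on the bottom disc, `Γ₁` on the top disc and vertical sutures between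
successive marked points, by rounding the corners.  The end `Sum.inl i` is the marked point `i` on
the bottom and `Sum.inr i` the marked point `i` on the top; along the rounded corners the vertical
sutures join the marked point `i` on the top to the marked point `i + 1` (cyclically) on the
bottom. -/
inductive SutureArc {n : ℕ} (Γ₀ Γ₁ : ChordDiagram n) :
    Fin (2 * n) ⊕ Fin (2 * n) → Fin (2 * n) ⊕ Fin (2 * n) → Prop
  | bottom (i) : SutureArc Γ₀ Γ₁ (Sum.inl i) (Sum.inl (Γ₀.partner i))
  | top (i) : SutureArc Γ₀ Γ₁ (Sum.inr i) (Sum.inr (Γ₁.partner i))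
  | side (i) : SutureArc Γ₀ Γ₁ (Sum.inr i) (Sum.inl (finRotate (2 * n) i))

/-- `Γ₁` is stackable on `Γ₀`: the sutured cylinder `M(Γ₀, Γ₁)` is tight, that is, after rounding
corners its sutures are connected. -/
def IsStackableOn {n : ℕ} (Γ₁ Γ₀ : ChordDiagram n) : Prop :=
  (SimpleGraph.fromRel (SutureArc Γ₀ Γ₁)).Connected

end ChordDiagram

/-- The positions of the minus signs (the letters `false`) in a word. -/
def minusPositions {n : ℕ} (w : Fin n → Bool) : Finset (Fin n) :=
  Finset.univ.filter fun i => w i = false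

/-- The partial order on words: `w₁` and `w₂` have the same number of minus signs (and of plus
signs), and for each `i` the `i`-th minus sign of `w₁` is to the left of, or in the same position
as, the `i`-th minus sign of `w₂`. -/
def WordLE {n : ℕ} (w₁ w₂ : Fin n → Bool) : Prop :=
  ∃ h : (minusPositions w₁).card = (minusPositions w₂).card,
    ∀ i : Fin (minusPositions w₂).card,
      (minusPositions w₁).orderEmbOfFin h i ≤ (minusPositions w₂).orderEmbOfFin rfl i

/-! The number of suture curves depends only on two fixed-point-free involutions of the marked
points: the chords of `Γ₀`, and the chords of `Γ₁` shifted by one step. Stackability says that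
together they act transitively (`isStackableOn_iff`); its indicator modulo 2 is `pairing Γ₀ Γ₁`.

The pairing is bilinear on `SFH`. For any fixed matching, an even number of the three diagrams of a
bypass triple close up with it to a single curve. Planarity is not needed here: contracting arcs
outside the sub-disc leaves a finite check on matchings of six points
(`sum_transitiveIndicator_eq_zero`).

On basis diagrams the pairing is the indicator of `WordLE` (`pairing_ofWord`), by recursion on the
first letters. Two plus signs cancel; plus below minus creates a separate closed curve; a minus
below acts as a cap on the last two points of the top diagram, which deletes the first minus sign of
the top word, or creates a closed curve if there is none.

The basis diagrams span because one bypass relation near the base point writes any diagram as a sum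
of diagrams with an outermost chord there (`exists_createPlus_add_createMinus`), and the creation
operators are linear. They are independent because the matrix of `WordLE` is unitriangular.
Expanding both arguments of the pairing then counts the comparable pairs modulo 2
(`pairing_eq_card`). -/

/-! ### Transitivity of a pair of involutions -/

/-- Two self-maps of a type act transitively: a predicate invariant under both is constant. -/
def IsTransitivePair {V : Type*} (α β : V → V) : Prop :=
  ∀ x : V → Prop, (∀ v, x (α v) ↔ x v) → (∀ v, x (β v) ↔ x v) → ∀ u v, x u ↔ x v

namespace IsTransitivePair

theorem comm {V : Type*} {α β : V → V} : IsTransitivePair α β ↔ IsTransitivePair β α :=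
  ⟨fun h x hβ hα => h x hα hβ, fun h x hα hβ => h x hβ hα⟩

theorem congr_equiv {V W : Type*} (f : W ≃ V) {α β : V → V} {α' β' : W → W}
    (hα : ∀ w, f (α' w) = α (f w)) (hβ : ∀ w, f (β' w) = β (f w)) :
    IsTransitivePair α β ↔ IsTransitivePair α' β' := by
  constructor
  · intro h x h₁ h₂ u v
    have := h (x ∘ f.symm) (fun v => ?_) (fun v => ?_) (f u) (f v)
    · simpa using this
    · obtain ⟨w, rfl⟩ := f.surjective v
      simpa [← hα] using h₁ w
    · obtain ⟨w, rfl⟩ := f.surjective v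
      simpa [← hβ] using h₂ w
  · intro h x h₁ h₂ u v
    have := h (x ∘ f) (fun w => ?_) (fun w => ?_) (f.symm u) (f.symm v)
    · simpa using this
    · simpa [hα] using h₁ (f w)
    · simpa [hβ] using h₂ (f w)

/-- A common two-element orbit obstructs transitivity. -/
theorem not_of_orbit {V : Type*} {α β : V → V} (hα : Function.Involutive α)
    (hβ : Function.Involutive β) {i j k : V} (hαi : α i = j) (hβi : β i = j)
    (hki : k ≠ i) (hkj : k ≠ j) : ¬ IsTransitivePair α β := by
  intro h
  have key : ∀ γ : V → V, Function.Involutive γ → γ i = j →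
      ∀ v, (γ v = i ∨ γ v = j) ↔ (v = i ∨ v = j) := by
    intro γ hγ hi v
    have hj : γ j = i := by rw [← hi, hγ]
    constructor
    · rintro (h | h)
      · right; rw [← hγ v, h, hi]
      · left; rw [← hγ v, h, hj]
    · rintro (rfl | rfl)
      · exact Or.inr hi
      · exact Or.inl hj
  have := (h (fun v => v = i ∨ v = j) (key α hα hαi) (key β hβ hβi) i k).1 (Or.inl rfl)
  tauto

/-- Elimination of a pair of points `i`, `j` exchanged by `α`: the images of `i` and `j` under `β`
are then exchanged by the second involution. -/
theorem eliminate {V W : Type*} {α β : V → V} {α' β' : W → W} (f : W → V)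
    (hf : Function.Injective f) {i j : V} (hα : Function.Involutive α)
    (hβ : Function.Involutive β) (hαi : α i = j) (hβi : β i ≠ i) (hβj : β j ≠ j) (hij : β i ≠ j)
    (hrange : ∀ v, v = i ∨ v = j ∨ ∃ w, f w = v) (hi : ∀ w, f w ≠ i) (hj : ∀ w, f w ≠ j)
    (hα' : ∀ w, f (α' w) = α (f w))
    (hβ' : ∀ w, β (f w) ≠ i → β (f w) ≠ j → f (β' w) = β (f w))
    (hβ'i : ∀ w, β (f w) = i → f (β' w) = β j)
    (hβ'j : ∀ w, β (f w) = j → f (β' w) = β i) :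
    IsTransitivePair α β ↔ IsTransitivePair α' β' := by
  have hαj : α j = i := by rw [← hαi, hα]
  have hji : β j ≠ i := fun h => hij (by rw [← h, hβ])
  obtain ⟨p, hp⟩ : ∃ w, f w = β i := by have := hrange (β i); tauto
  obtain ⟨q, hq⟩ : ∃ w, f w = β j := by have := hrange (β j); tauto
  have hpq : β' p = q := hf (by rw [hβ'i p (by rw [hp, hβ]), hq])
  constructor
  · intro h x h₁ h₂ u v
    have hxpq : x q ↔ x p := by rw [← hpq]; exact h₂ p
    -- The path `p`, `i`, `j`, `q` is contracted to the single `β'`-arc from `p` to `q`, so an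
    -- invariant predicate extends to `i` and `j` by its common value at `p` and `q`.
    let y : V → Prop := fun v => ((v = i ∨ v = j) ∧ x p) ∨ ∃ w, f w = v ∧ x w
    have yf : ∀ w, y (f w) ↔ x w := by
      intro w
      constructor
      · rintro (⟨h | h, -⟩ | ⟨w', h, hx⟩)
        · exact absurd h (hi w)
        · exact absurd h (hj w)
        · rwa [← hf h]
      · exact fun h => Or.inr ⟨w, rfl, h⟩
    have yi : y i ↔ x p := by
      constructor
      · rintro (⟨-, h⟩ | ⟨w', h, hx⟩)
        · exact h
        · exact absurd h (hi w')
      · exact fun h => Or.inl ⟨Or.inl rfl, h⟩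
    have yj : y j ↔ x p := by
      constructor
      · rintro (⟨-, h⟩ | ⟨w', h, hx⟩)
        · exact h
        · exact absurd h (hj w')
      · exact fun h => Or.inl ⟨Or.inr rfl, h⟩
    have := h y (fun v => ?_) (fun v => ?_) (f u) (f v)
    · rwa [yf, yf] at this
    · rcases hrange v with rfl | rfl | ⟨w, rfl⟩
      · rw [hαi, yi, yj]
      · rw [hαj, yi, yj]
      · rw [← hα', yf, yf, h₁]
    · rcases hrange v with rfl | rfl | ⟨w, rfl⟩
      · rw [← hp, yf, yi]
      · rw [← hq, yf, yj, hxpq]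
      · by_cases hwi : β (f w) = i
        · have : w = p := hf (by rw [hp, ← hwi, hβ])
          rw [hwi, yi, yf, this]
        · by_cases hwj : β (f w) = j
          · have : w = q := hf (by rw [hq, ← hwj, hβ])
            rw [hwj, yj, yf, this, hxpq]
          · rw [← hβ' w hwi hwj, yf, yf, h₂]
  · intro h x h₁ h₂
    have hc := h (x ∘ f) (fun w => ?_) (fun w => ?_)
    · have hxi : x i ↔ x (f p) := by rw [hp, h₂]
      have hxj : x j ↔ x (f p) := by rw [← hxi, ← hαi, h₁]
      have key : ∀ v, x v ↔ x (f p) := by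
        intro v
        rcases hrange v with rfl | rfl | ⟨w, rfl⟩
        · exact hxi
        · exact hxj
        · exact hc w p
      intro u v
      rw [key u, key v]
    · simp only [Function.comp_apply, hα', h₁]
    · simp only [Function.comp_apply]
      by_cases hwi : β (f w) = i
      · rw [hβ'i w hwi, h₂, ← h₂ (f w), hwi, ← hαi, h₁]
      · by_cases hwj : β (f w) = j
        · rw [hβ'j w hwj, h₂, ← h₂ (f w), hwj, ← hαi, h₁]
        · rw [hβ' w hwi hwj, h₂]

/-- Boolean colourings make transitivity decidable on a finite type, as the check on six points
requires. -/
theorem iff_forall_bool {V : Type*} {α β : V → V} : IsTransitivePair α β ↔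
    ∀ x : V → Bool, (∀ v, x (α v) = x v) → (∀ v, x (β v) = x v) → ∀ u v, x u = x v := by
  classical
  constructor
  · intro h x h₁ h₂ u v
    have := h (fun v => x v = true) (fun v => by simp [h₁]) (fun v => by simp [h₂]) u v
    exact Bool.eq_iff_iff.2 this
  · intro h x h₁ h₂ u v
    have := h (fun v => decide (x v)) (fun v => by simp [h₁]) (fun v => by simp [h₂]) u v
    simpa using this

end IsTransitivePair

/-- The indicator modulo `2` of transitivity. -/
noncomputable def transitiveIndicator {V : Type*} (α β : V → V) : ZMod 2 :=
  open Classical in if IsTransitivePair α β then 1 else 0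

theorem transitiveIndicator_congr {V W : Type*} {α β : V → V} {α' β' : W → W}
    (h : IsTransitivePair α β ↔ IsTransitivePair α' β') :
    transitiveIndicator α β = transitiveIndicator α' β' := by
  rw [transitiveIndicator, transitiveIndicator, propext h]

theorem transitiveIndicator_eq_zero {V : Type*} {α β : V → V} (h : ¬ IsTransitivePair α β) :
    transitiveIndicator α β = 0 := if_neg h

/-! ### The bypass relation for arbitrary matchings -/

/-- The three pairings of six points in a bypass triple. -/
def bypassPairing : Fin 3 → Fin 6 → Fin 6 :=
  ![![1, 0, 5, 4, 3, 2], ![3, 2, 1, 0, 5, 4], ![5, 4, 3, 2, 1, 0]]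

-- Exhaustive check over the 15 perfect matchings of six points. The matching is listed by its
-- values, and each value is constrained against the earlier ones as soon as it is introduced, which
-- prunes the search.
set_option synthInstance.maxSize 4096 in
set_option synthInstance.maxHeartbeats 1000000 in
theorem sum_transitive_bypassPairing_vec :
    ∀ b₀ : Fin 6, b₀ ≠ 0 →
    ∀ b₁ : Fin 6, b₁ ≠ 1 ∧ (b₀ = 1 ↔ b₁ = 0) →
    ∀ b₂ : Fin 6, b₂ ≠ 2 ∧ (b₀ = 2 ↔ b₂ = 0) ∧ (b₁ = 2 ↔ b₂ = 1) →
    ∀ b₃ : Fin 6, b₃ ≠ 3 ∧ (b₀ = 3 ↔ b₃ = 0) ∧ (b₁ = 3 ↔ b₃ = 1) ∧ (b₂ = 3 ↔ b₃ = 2) →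
    ∀ b₄ : Fin 6, b₄ ≠ 4 ∧ (b₀ = 4 ↔ b₄ = 0) ∧ (b₁ = 4 ↔ b₄ = 1) ∧ (b₂ = 4 ↔ b₄ = 2) ∧
      (b₃ = 4 ↔ b₄ = 3) →
    ∀ b₅ : Fin 6, b₅ ≠ 5 ∧ (b₀ = 5 ↔ b₅ = 0) ∧ (b₁ = 5 ↔ b₅ = 1) ∧ (b₂ = 5 ↔ b₅ = 2) ∧
      (b₃ = 5 ↔ b₅ = 3) ∧ (b₄ = 5 ↔ b₅ = 4) →
    ∑ k, (if ∀ x : Fin 6 → Bool, (∀ v, x (bypassPairing k v) = x v) →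
      (∀ v : Fin 6, x (![b₀, b₁, b₂, b₃, b₄, b₅] v) = x v) → ∀ v, x 0 = x v
      then (1 : ZMod 2) else 0) = 0 := by
  decide +kernel

theorem sum_transitiveIndicator_bypassPairing {β : Fin 6 → Fin 6} (hβ : Function.Involutive β)
    (hne : ∀ i, β i ≠ i) : ∑ k, transitiveIndicator (bypassPairing k) β = 0 := by
  have h : ∀ i j, β i = j ↔ β j = i := fun i j =>
    ⟨fun h => by rw [← h, hβ], fun h => by rw [← h, hβ]⟩
  have := sum_transitive_bypassPairing_vec
    (β 0) (hne 0)
    (β 1) ⟨hne 1, h _ _⟩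
    (β 2) ⟨hne 2, h _ _, h _ _⟩
    (β 3) ⟨hne 3, h _ _, h _ _, h _ _⟩
    (β 4) ⟨hne 4, h _ _, h _ _, h _ _, h _ _⟩
    (β 5) ⟨hne 5, h _ _, h _ _, h _ _, h _ _, h _ _⟩
  have hvec : ![β 0, β 1, β 2, β 3, β 4, β 5] = β := by
    ext i; fin_cases i <;> rfl
  rw [hvec] at this
  rw [← this]
  refine Finset.sum_congr rfl fun k _ => ?_
  have hiff : IsTransitivePair (bypassPairing k) β ↔ ∀ x : Fin 6 → Bool,
      (∀ v, x (bypassPairing k v) = x v) → (∀ v, x (β v) = x v) → ∀ v, x 0 = x v := by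
    rw [IsTransitivePair.iff_forall_bool]
    exact ⟨fun h x h₁ h₂ v => h x h₁ h₂ 0 v, fun h x h₁ h₂ u v =>
      (h x h₁ h₂ u).symm.trans (h x h₁ h₂ v)⟩
  unfold transitiveIndicator
  by_cases hT : IsTransitivePair (bypassPairing k) β
  · rw [if_pos hT, if_pos (hiff.1 hT)]
  · rw [if_neg hT, if_neg (mt hiff.2 hT)]

/-- The bypass relation for pairs of matchings: planarity plays no role. -/
theorem sum_transitiveIndicator_eq_zero {V : Type*} [Finite V] {α : Fin 3 → V → V} {β : V → V}
    (a : Fin 6 → V) (ha : Function.Injective a) (hα : ∀ k, Function.Involutive (α k))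
    (hαne : ∀ k v, α k v ≠ v) (hβ : Function.Involutive β) (hβne : ∀ v, β v ≠ v)
    (haα : ∀ k i, α k (a i) = a (bypassPairing k i))
    (hout : ∀ v, v ∉ Set.range a → ∀ k l, α k v = α l v) :
    ∑ k, transitiveIndicator (α k) β = 0 := by
  -- The points outside the six are removed two at a time, along an arc common to the three
  -- matchings.
  induction hN : Nat.card V using Nat.strong_induction_on generalizing V with
  | _ N ih =>
  by_cases hsurj : Function.Surjective a
  · let f : Fin 6 ≃ V := Equiv.ofBijective a ⟨ha, hsurj⟩
    have hf : ∀ i, f i = a i := fun i => rfl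
    rw [← sum_transitiveIndicator_bypassPairing (β := fun i => f.symm (β (f i)))
      (fun i => by simp [hβ _]) (fun i h => hβne (f i) (by
        have := congrArg f h; simpa using this))]
    refine Finset.sum_congr rfl fun k _ => transitiveIndicator_congr ?_
    exact IsTransitivePair.congr_equiv f (fun w => by rw [hf, hf, haα]) (fun w => by simp)
  · obtain ⟨i, hi⟩ : ∃ i, i ∉ Set.range a := by
      simpa [Function.Surjective] using hsurj
    obtain ⟨j, hj⟩ : ∃ j, j = α 0 i := ⟨_, rfl⟩
    have hαi : ∀ k, α k i = j := fun k => by rw [hj]; exact hout i hi k 0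
    have hαj : ∀ k, α k j = i := fun k => by rw [← hαi k, hα]
    have hjr : j ∉ Set.range a := by
      rintro ⟨l, rfl⟩
      exact hi ⟨_, ((haα 0 l).symm.trans (hαj 0))⟩
    -- If `β` also joins `i` and `j`, they form a closed curve that misses `a 0`, and all three
    -- terms vanish. Otherwise the arc is contracted, and `β'` joins the `β`-neighbours of `i` and
    -- `j` to each other.
    by_cases hij : β i = j
    · refine Finset.sum_eq_zero fun k _ => transitiveIndicator_eq_zero ?_
      exact IsTransitivePair.not_of_orbit (k := a 0) (hα k) hβ (hαi k) hij
        (fun h => hi ⟨_, h⟩) (fun h => hjr ⟨_, h⟩)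
    · have hji : β j ≠ i := fun h => hij (by rw [← h, hβ])
      classical
      let W := {v : V // v ≠ i ∧ v ≠ j}
      have hαW : ∀ k (w : W), α k w ≠ i ∧ α k w ≠ j := fun k w =>
        ⟨fun h => w.2.2 (by rw [← hα k w, h, hαi]), fun h => w.2.1 (by rw [← hα k w, h, hαj])⟩
      let α' : Fin 3 → W → W := fun k w => ⟨α k w, hαW k w⟩
      have hβW : ∀ w : W, (if β w = i then β j else if β w = j then β i else β w) ≠ i ∧
          (if β w = i then β j else if β w = j then β i else β w) ≠ j := by
        intro w
        have := hβne i
        have := hβne j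
        split_ifs <;> tauto
      let β' : W → W := fun w => ⟨_, hβW w⟩
      have hβ'v : ∀ w : W, (β' w : V) = if β w = i then β j else if β w = j then β i else β w :=
        fun w => rfl
      have key : ∀ k, transitiveIndicator (α k) β = transitiveIndicator (α' k) β' := by
        intro k
        refine transitiveIndicator_congr (IsTransitivePair.eliminate (i := i) (j := j)
          (fun w : W => (w : V)) Subtype.val_injective (hα k) hβ (hαi k) (hβne i) (hβne j) hij ?_
          (fun w => w.2.1) (fun w => w.2.2) (fun w => rfl) ?_ ?_ ?_)
        · intro v
          by_cases h₁ : v = i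
          · exact Or.inl h₁
          by_cases h₂ : v = j
          · exact Or.inr (Or.inl h₂)
          exact Or.inr (Or.inr ⟨⟨v, h₁, h₂⟩, rfl⟩)
        · intro w h₁ h₂
          simp only [hβ'v, if_neg h₁, if_neg h₂]
        · intro w h₁
          simp only [hβ'v, if_pos h₁]
        · intro w h₂
          have hne : j ≠ i := by rw [← hαi 0]; exact hαne 0 i
          simp only [hβ'v, h₂, if_neg hne, if_true]
      rw [Finset.sum_congr rfl fun k _ => key k]
      refine ih (Nat.card W) ?_ (V := W) (fun l => ⟨a l, fun h => hi ⟨_, h⟩, fun h => hjr ⟨_, h⟩⟩)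
        (fun l m h => ha (congrArg Subtype.val h)) (fun k w => Subtype.ext (hα k w))
        (fun k w h => hαne k w (congrArg Subtype.val h)) ?_ ?_
        (fun k l => Subtype.ext (haα k l)) ?_ rfl
      · rw [← hN]
        exact Finite.card_subtype_lt (x := i) (by simp)
      · intro w
        apply Subtype.ext
        rw [hβ'v, hβ'v]
        have e₁ := hβ i
        have e₂ := hβ j
        have e₃ := hβ w
        by_cases h₁ : β w = i
        · have hne : j ≠ i := by rw [← hαi 0]; exact hαne 0 i
          have h₃ : β i = w := (congrArg β h₁).symm.trans e₃
          rw [if_pos h₁, e₂, if_neg hne, if_pos rfl, h₃]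
        · by_cases h₂ : β w = j
          · have h₃ : β j = w := (congrArg β h₂).symm.trans e₃
            rw [if_neg h₁, if_pos h₂, e₁, if_pos rfl, h₃]
          · simp [h₁, h₂, e₃, w.2.1, w.2.2]
      · intro w h
        have h := congrArg Subtype.val h
        rw [hβ'v] at h
        have hij' : j ≠ i := by rw [← hαi 0]; exact hαne 0 i
        have e₁ := hβ i
        have e₂ := hβ j
        have e₃ := hβ w
        split_ifs at h with h₁ h₂
        · rw [← h, e₂] at h₁; exact hij' h₁
        · rw [← h, e₁] at h₂; exact hij' h₂.symm
        · exact hβne w h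
      · intro w hw k l
        refine Subtype.ext (hout w (fun ⟨m, hm⟩ => hw ⟨m, Subtype.ext hm⟩) k l)

/-! ### Stackability as transitivity -/

/-- Reachability from a fixed vertex is itself an invariant predicate. This puts connectedness in
the form of `IsTransitivePair`. -/
theorem SimpleGraph.connected_iff_forall_invariant {V : Type*} [Nonempty V] (G : SimpleGraph V) :
    G.Connected ↔ ∀ x : V → Prop, (∀ u v, G.Adj u v → (x u ↔ x v)) → ∀ u v, x u ↔ x v := by
  constructor
  · intro h x hx u v
    obtain ⟨p⟩ := h.preconnected u v
    induction p with
    | nil => rfl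
    | cons hadj _ ih => exact (hx _ _ hadj).trans ih
  · intro h
    refine ⟨fun u v => ?_⟩
    refine (h (fun w => G.Reachable u w) (fun w w' hadj => ?_) u v).1 (SimpleGraph.Reachable.refl u)
    exact ⟨fun h => h.trans hadj.reachable, fun h => h.trans hadj.symm.reachable⟩

theorem finRotate_val {m : ℕ} (i : Fin m) :
    ((i : ℕ) + 1 = m ∧ (finRotate m i : ℕ) = 0) ∨
      ((i : ℕ) + 1 < m ∧ (finRotate m i : ℕ) = i + 1) := by
  cases m with
  | zero => exact i.elim0
  | succ m =>
    rw [coe_finRotate]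
    split_ifs with h
    · left; simp [h]
    · right
      have : (i : ℕ) ≠ m := fun h' => h (Fin.ext h')
      exact ⟨by omega, rfl⟩

theorem finRotate_symm_val {m : ℕ} (i : Fin m) :
    ((i : ℕ) = 0 ∧ ((finRotate m).symm i : ℕ) + 1 = m) ∨
      ((i : ℕ) ≠ 0 ∧ ((finRotate m).symm i : ℕ) + 1 = i) := by
  have := finRotate_val ((finRotate m).symm i)
  rw [Equiv.apply_symm_apply] at this
  omega

namespace ChordDiagram

theorem partner_involutive {n : ℕ} (Γ : ChordDiagram n) : Function.Involutive Γ.partner :=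
  Γ.partner_partner

/-- The pairing of the marked points of the bottom disc of a sutured cylinder that is induced by
the chords on the top disc. -/
def topPartner {n : ℕ} (Γ : ChordDiagram n) (i : Fin (2 * n)) : Fin (2 * n) :=
  finRotate (2 * n) (Γ.partner ((finRotate (2 * n)).symm i))

theorem topPartner_finRotate {n : ℕ} (Γ : ChordDiagram n) (i : Fin (2 * n)) :
    Γ.topPartner (finRotate (2 * n) i) = finRotate (2 * n) (Γ.partner i) := by
  rw [topPartner, Equiv.symm_apply_apply]

theorem topPartner_involutive {n : ℕ} (Γ : ChordDiagram n) :
    Function.Involutive Γ.topPartner := fun i => by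
  rw [topPartner, topPartner, Equiv.symm_apply_apply, partner_partner, Equiv.apply_symm_apply]

theorem topPartner_ne {n : ℕ} (Γ : ChordDiagram n) (i : Fin (2 * n)) : Γ.topPartner i ≠ i := by
  intro h
  refine Γ.partner_ne ((finRotate (2 * n)).symm i) ?_
  rw [Equiv.eq_symm_apply]
  exact h

/-- The side arcs identify each top end with the next bottom end, so the top ends can be contracted
away. Conversely, a predicate on the bottom ends extends to the top end `i` by its value at the
rotated point. -/
theorem isStackableOn_iff {n : ℕ} (Γ₁ Γ₀ : ChordDiagram (n + 1)) :
    Γ₁.IsStackableOn Γ₀ ↔ IsTransitivePair Γ₀.partner Γ₁.topPartner := by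
  have : Nonempty (Fin (2 * (n + 1))) := ⟨⟨0, by omega⟩⟩
  rw [IsStackableOn, SimpleGraph.connected_iff_forall_invariant]
  constructor
  · intro h x h₀ h₁ u v
    refine h (Sum.elim x fun i => x (finRotate _ i)) (fun a b hab => ?_) (Sum.inl u) (Sum.inl v)
    have key : ∀ a b, SutureArc Γ₀ Γ₁ a b → ((Sum.elim x fun i => x (finRotate _ i)) a ↔
        (Sum.elim x fun i => x (finRotate _ i)) b) := by
      intro a b hab
      cases hab with
      | bottom i => simp [h₀]
      | top i => rw [Sum.elim_inr, Sum.elim_inr, ← topPartner_finRotate, h₁]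
      | side i => simp
    rw [SimpleGraph.fromRel_adj] at hab
    rcases hab.2 with h | h
    · exact key a b h
    · exact (key b a h).symm
  · intro h x hx
    have key : ∀ a b, SutureArc Γ₀ Γ₁ a b → (x a ↔ x b) := by
      intro a b hab
      by_cases hne : a = b
      · rw [hne]
      · exact hx a b ((SimpleGraph.fromRel_adj _ _ _).2 ⟨hne, Or.inl hab⟩)
    have hc := h (fun i => x (Sum.inl i)) (fun i => (key _ _ (.bottom i)).symm) (fun i => ?_)
    · have hr : ∀ i, x (Sum.inr i) ↔ x (Sum.inl i) := fun i =>
        (key _ _ (.side i)).trans (hc _ _)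
      rintro (u | u) (v | v)
      · exact hc u v
      · rw [hr]; exact hc u v
      · rw [hr]; exact hc u v
      · rw [hr, hr]; exact hc u v
    · obtain ⟨j, rfl⟩ := (finRotate _).surjective i
      rw [topPartner_finRotate]
      exact (key _ _ (.side _)).symm.trans ((key _ _ (.top j)).symm.trans (key _ _ (.side j)))

/-! ### The pairing and its bilinearity on `SFH` -/

/-- The stackability pairing of two chord diagrams. -/
noncomputable def pairing {n : ℕ} (Γ₀ Γ₁ : ChordDiagram n) : ZMod 2 :=
  transitiveIndicator Γ₀.partner Γ₁.topPartner

theorem isStackableOn_iff_pairing {n : ℕ} (Γ₁ Γ₀ : ChordDiagram (n + 1)) :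
    Γ₁.IsStackableOn Γ₀ ↔ pairing Γ₀ Γ₁ = 1 := by
  rw [isStackableOn_iff, pairing, transitiveIndicator]
  split_ifs with h <;> simp [h]

theorem IsBypassTriple.exists_bypassPairing {n : ℕ} {Γ₁ Γ₂ Γ₃ : ChordDiagram n}
    (h : IsBypassTriple Γ₁ Γ₂ Γ₃) : ∃ a : Fin 6 → Fin (2 * n), Function.Injective a ∧
      (∀ k i, (![Γ₁, Γ₂, Γ₃] k).partner (a i) = a (bypassPairing k i)) ∧
      ∀ v, v ∉ Set.range a → ∀ k l,
        (![Γ₁, Γ₂, Γ₃] k).partner v = (![Γ₁, Γ₂, Γ₃] l).partner v := by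
  obtain ⟨a, ha, ⟨h₁, h₂, h₃⟩, ⟨h₄, h₅, h₆⟩, ⟨h₇, h₈, h₉⟩, hout⟩ := h
  have flip : ∀ (Γ : ChordDiagram n) {i j}, Γ.partner i = j → Γ.partner j = i :=
    fun Γ i j h => by rw [← h, Γ.partner_partner]
  refine ⟨a, ha.injective, ?_, ?_⟩
  · intro k i
    fin_cases k <;> fin_cases i
    exacts [h₁, flip _ h₁, h₂, h₃, flip _ h₃, flip _ h₂, h₅, h₄, flip _ h₄, flip _ h₅, h₆,
      flip _ h₆, flip _ h₉, h₈, h₇, flip _ h₇, flip _ h₈, h₉]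
  · intro v hv k l
    obtain ⟨e₁, e₂⟩ := hout v fun k hk => hv ⟨k, hk.symm⟩
    fin_cases k <;> fin_cases l <;> simp [e₁, e₂]

theorem pairing_bypass_left {n : ℕ} {Γ₁ Γ₂ Γ₃ : ChordDiagram n}
    (h : IsBypassTriple Γ₁ Γ₂ Γ₃) (Γ : ChordDiagram n) :
    pairing Γ₁ Γ + pairing Γ₂ Γ + pairing Γ₃ Γ = 0 := by
  obtain ⟨a, ha, h₁, h₂⟩ := h.exists_bypassPairing
  have := sum_transitiveIndicator_eq_zero (α := fun k => (![Γ₁, Γ₂, Γ₃] k).partner) a ha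
    (fun k => partner_involutive _) (fun k => partner_ne _) Γ.topPartner_involutive
    Γ.topPartner_ne h₁ h₂
  simp only [Fin.sum_univ_three] at this
  exact this

/-- Transitivity is symmetric in the two involutions, and the shifted six points need only be
distinct: their order on the circle plays no role in `sum_transitiveIndicator_eq_zero`. -/
theorem pairing_bypass_right {n : ℕ} {Γ₁ Γ₂ Γ₃ : ChordDiagram n}
    (h : IsBypassTriple Γ₁ Γ₂ Γ₃) (Γ : ChordDiagram n) :
    pairing Γ Γ₁ + pairing Γ Γ₂ + pairing Γ Γ₃ = 0 := by
  obtain ⟨a, ha, h₁, h₂⟩ := h.exists_bypassPairing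
  have := sum_transitiveIndicator_eq_zero (α := fun k => (![Γ₁, Γ₂, Γ₃] k).topPartner)
    (fun i => finRotate _ (a i)) ((finRotate _).injective.comp ha)
    (fun k => topPartner_involutive _) (fun k => topPartner_ne _) Γ.partner_involutive
    Γ.partner_ne (fun k i => by rw [topPartner_finRotate, h₁]) (fun v hv k l => by
      obtain ⟨w, rfl⟩ := (finRotate _).surjective v
      rw [topPartner_finRotate, topPartner_finRotate, h₂ w _ k l]
      rintro ⟨i, rfl⟩
      exact hv ⟨i, rfl⟩)
  simp only [Fin.sum_univ_three] at this
  have hc : ∀ Δ : ChordDiagram n,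
      pairing Γ Δ = transitiveIndicator Δ.topPartner Γ.partner := fun Δ =>
    transitiveIndicator_congr IsTransitivePair.comm
  rw [hc, hc, hc]
  exact this

/-- The linear map on `SFH n` determined by values on chord diagrams that satisfy the bypass
relations. -/
noncomputable def liftSFH {n : ℕ} {M : Type*} [AddCommGroup M] [Module (ZMod 2) M]
    (φ : ChordDiagram n → M)
    (hφ : ∀ Γ₁ Γ₂ Γ₃, IsBypassTriple Γ₁ Γ₂ Γ₃ → φ Γ₁ + φ Γ₂ + φ Γ₃ = 0) :
    SFH n →ₗ[ZMod 2] M :=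
  (bypassRelations n).liftQ (Finsupp.linearCombination (ZMod 2) φ) (by
    rw [bypassRelations, Submodule.span_le]
    rintro x ⟨Γ₁, Γ₂, Γ₃, h, rfl⟩
    simpa using hφ _ _ _ h)

theorem liftSFH_toSFH {n : ℕ} {M : Type*} [AddCommGroup M] [Module (ZMod 2) M]
    (φ : ChordDiagram n → M)
    (hφ : ∀ Γ₁ Γ₂ Γ₃, IsBypassTriple Γ₁ Γ₂ Γ₃ → φ Γ₁ + φ Γ₂ + φ Γ₃ = 0)
    (Γ : ChordDiagram n) : liftSFH φ hφ Γ.toSFH = φ Γ := by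
  simp [liftSFH, toSFH]

theorem toSFH_bypass {n : ℕ} {Γ₁ Γ₂ Γ₃ : ChordDiagram n} (h : IsBypassTriple Γ₁ Γ₂ Γ₃) :
    Γ₁.toSFH + Γ₂.toSFH + Γ₃.toSFH = 0 := by
  rw [toSFH, toSFH, toSFH, ← map_add, ← map_add, Submodule.mkQ_apply,
    Submodule.Quotient.mk_eq_zero]
  exact Submodule.subset_span ⟨_, _, _, h, rfl⟩

end ChordDiagram

namespace ChordDiagram

/-! ### Marked points under the creation operators -/

theorem createPlus_partner_val {n : ℕ} (Γ : ChordDiagram n) (i : Fin (2 * n))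
    (k : Fin (2 * (n + 1)))
    (hk : (k : ℕ) = i + 2) : ((createPlus Γ).partner k : ℕ) = Γ.partner i + 2 := by
  have h : ¬ (k : ℕ) < 2 := by omega
  have e : (⟨(k : ℕ) - 2, by omega⟩ : Fin (2 * n)) = i := by ext; simp only; omega
  simp only [createPlus, h, dif_neg, not_false_eq_true, e]

theorem createPlus_partner_of_lt {n : ℕ} (Γ : ChordDiagram n) (k : Fin (2 * (n + 1)))
    (hk : (k : ℕ) < 2) : ((createPlus Γ).partner k : ℕ) = 1 - k := by
  simp only [createPlus, hk, dif_pos]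

theorem minusEmb_injective {n : ℕ} : Function.Injective (minusEmb (n := n)) := by
  intro i j h
  have := minusEmb_val i
  have := minusEmb_val j
  rw [h] at *
  ext; omega

theorem createMinus_partner_minusEmb {n : ℕ} (Γ : ChordDiagram n) (i : Fin (2 * n)) :
    (createMinus Γ).partner (minusEmb i) = minusEmb (Γ.partner i) := by
  have e := minusEmb_val i
  have h : ¬ ((minusEmb i : ℕ) = 0 ∨ (minusEmb i : ℕ) = 2 * n + 1) := by omega
  have e₁ : minusInv (minusEmb i) h = i := by
    have := minusInv_val (minusEmb i) h
    ext; omega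
  simp only [createMinus, h, dif_neg, not_false_eq_true, e₁]

theorem createMinus_partner_of_end {n : ℕ} (Γ : ChordDiagram n) (k : Fin (2 * (n + 1)))
    (hk : (k : ℕ) = 0 ∨ (k : ℕ) = 2 * n + 1) :
    ((createMinus Γ).partner k : ℕ) = 2 * n + 1 - k := by
  simp only [createMinus, hk, dif_pos]

theorem eq_minusEmb {n : ℕ} (k : Fin (2 * (n + 1))) :
    k = ⟨0, by omega⟩ ∨ k = ⟨2 * n + 1, by omega⟩ ∨ ∃ i : Fin (2 * n), minusEmb i = k := by
  by_cases h : (k : ℕ) = 0 ∨ (k : ℕ) = 2 * n + 1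
  · rcases h with h | h
    · exact Or.inl (Fin.ext h)
    · exact Or.inr (Or.inl (Fin.ext h))
  · refine Or.inr (Or.inr ⟨minusInv k h, ?_⟩)
    have := minusInv_val k h
    have := minusEmb_val (minusInv k h)
    ext; omega

/-! ### The pairing and creation operators -/

/-- The new top chord joins the last point to the base point; the shift moves it to the points 0 and
1, where it closes up with the new bottom chord. -/
theorem pairing_createPlus_createMinus {n : ℕ} (Γ₀ Γ₁ : ChordDiagram (n + 1)) :
    pairing (createPlus Γ₀) (createMinus Γ₁) = 0 := by
  refine transitiveIndicator_eq_zero (IsTransitivePair.not_of_orbit (i := ⟨0, by omega⟩)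
    (j := ⟨1, by omega⟩) (k := ⟨2, by omega⟩) (partner_involutive _) (topPartner_involutive _)
    ?_ ?_ (by simp) (by simp))
  · ext
    rw [createPlus_partner_of_lt _ _ (by simp)]
    simp
  · have e₁ := finRotate_symm_val (⟨0, by omega⟩ : Fin (2 * (n + 1 + 1)))
    have e₂ := createMinus_partner_of_end Γ₁ ((finRotate _).symm ⟨0, by omega⟩)
      (by simp only at e₁; omega)
    have e₃ := finRotate_val ((createMinus Γ₁).partner ((finRotate _).symm ⟨0, by omega⟩))
    ext
    simp only [topPartner] at *
    omega

/-- The new bottom chord joins 0 to 1 and the shifted new top chord joins 1 to 2. Eliminating 0 and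
1 straightens this zigzag: the old base point, now 2, recovers the top arc that ends at 0. -/
theorem pairing_createPlus_createPlus {n : ℕ} (Γ₀ Γ₁ : ChordDiagram (n + 1)) :
    pairing (createPlus Γ₀) (createPlus Γ₁) = pairing Γ₀ Γ₁ := by
  -- Top arcs move by two, except that an end at 0, coming from the last point through the cyclic
  -- shift, stays at 0.
  have ht : ∀ w : Fin (2 * (n + 1)), (w : ℕ) ≠ 0 → ∀ v : Fin (2 * (n + 1 + 1)),
      (v : ℕ) = w + 2 → (((createPlus Γ₁).topPartner v : ℕ) = 0 ∧ (Γ₁.topPartner w : ℕ) = 0) ∨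
        ((createPlus Γ₁).topPartner v : ℕ) = Γ₁.topPartner w + 2 ∧ (Γ₁.topPartner w : ℕ) ≠ 0 := by
    intro w hw v hv
    have e₁ := finRotate_symm_val w
    have e₂ := finRotate_symm_val v
    have e₃ := createPlus_partner_val Γ₁ ((finRotate _).symm w) ((finRotate _).symm v) (by omega)
    have e₄ := finRotate_val (Γ₁.partner ((finRotate _).symm w))
    have e₅ := finRotate_val ((createPlus Γ₁).partner ((finRotate _).symm v))
    simp only [topPartner]
    omega
  have h₀ : ((createPlus Γ₁).topPartner ⟨0, by omega⟩ : ℕ) =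
      Γ₁.topPartner ⟨0, by omega⟩ + 2 := by
    have e₁ := finRotate_symm_val (⟨0, by omega⟩ : Fin (2 * (n + 1)))
    have e₂ := finRotate_symm_val (⟨0, by omega⟩ : Fin (2 * (n + 1 + 1)))
    simp only at e₁ e₂
    have e₃ := createPlus_partner_val Γ₁ ((finRotate _).symm ⟨0, by omega⟩)
      ((finRotate _).symm ⟨0, by omega⟩) (by omega)
    have e₄ := finRotate_val (Γ₁.partner ((finRotate _).symm ⟨0, by omega⟩))
    have e₅ := finRotate_val ((createPlus Γ₁).partner ((finRotate _).symm ⟨0, by omega⟩))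
    -- The partner of the last point is not the last point, so the shift does not wrap around.
    have e₆ : (Γ₁.partner ((finRotate _).symm ⟨0, by omega⟩) : ℕ) ≠
        (finRotate (2 * (n + 1))).symm ⟨0, by omega⟩ :=
      fun h => Γ₁.partner_ne _ (Fin.ext h)
    simp only [topPartner]
    omega
  have h₁ : (createPlus Γ₁).topPartner ⟨1, by omega⟩ = ⟨2, by omega⟩ := by
    have e₁ := finRotate_symm_val (⟨1, by omega⟩ : Fin (2 * (n + 1 + 1)))
    simp only at e₁
    have e₂ := createPlus_partner_of_lt Γ₁ ((finRotate _).symm ⟨1, by omega⟩) (by omega)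
    have e₃ := finRotate_val ((createPlus Γ₁).partner ((finRotate _).symm ⟨1, by omega⟩))
    ext
    simp only [topPartner]
    omega
  have h₂ : (createPlus Γ₁).topPartner ⟨2, by omega⟩ = ⟨1, by omega⟩ := by
    rw [← h₁, topPartner_involutive]
  have hW : ∀ w : Fin (2 * (n + 1)), (w : ℕ) = 0 → w = ⟨0, by omega⟩ := fun w h => Fin.ext h
  refine transitiveIndicator_congr (IsTransitivePair.eliminate
    (i := ⟨0, by omega⟩) (j := ⟨1, by omega⟩)
    (fun w : Fin (2 * (n + 1)) => (⟨w + 2, by omega⟩ : Fin (2 * (n + 1 + 1)))) ?_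
    (partner_involutive _) (topPartner_involutive _) ?_ (topPartner_ne _ _) (topPartner_ne _ _)
    ?_ ?_ (by simp) (by simp) ?_ ?_ ?_ ?_)
  · intro u v h
    simpa [Fin.ext_iff] using h
  · ext
    rw [createPlus_partner_of_lt _ _ (by simp)]
    simp
  · intro h
    rw [h] at h₀
    simp only at h₀
    omega
  · intro v
    by_cases hv₀ : (v : ℕ) = 0
    · exact Or.inl (Fin.ext hv₀)
    by_cases hv₁ : (v : ℕ) = 1
    · exact Or.inr (Or.inl (Fin.ext hv₁))
    exact Or.inr (Or.inr ⟨⟨v - 2, by omega⟩, Fin.ext (by simp only; omega)⟩)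
  · intro w
    ext
    rw [createPlus_partner_val Γ₀ w _ rfl]
  · intro w hi hj
    by_cases hw : (w : ℕ) = 0
    · obtain rfl := hW w hw
      exact absurd h₂ hj
    · have := ht w hw ⟨w + 2, by omega⟩ rfl
      have hi' : ((createPlus Γ₁).topPartner ⟨w + 2, by omega⟩ : ℕ) ≠ 0 := fun h => hi (Fin.ext h)
      ext
      simp only
      omega
  · intro w hi
    by_cases hw : (w : ℕ) = 0
    · obtain rfl := hW w hw
      have := h₂.symm.trans hi
      simp at this
    · have := ht w hw ⟨w + 2, by omega⟩ rfl
      rw [hi] at this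
      rw [h₁]
      ext
      simp only at *
      omega
  · intro w hj
    by_cases hw : (w : ℕ) = 0
    · obtain rfl := hW w hw
      ext
      exact h₀.symm
    · have := ht w hw ⟨w + 2, by omega⟩ rfl
      rw [hj] at this
      simp only at this
      omega

/-- `Δ'` is obtained from `Δ` by joining the last two marked points, which do not bound a chord. -/
structure IsCap {n : ℕ} (Δ : ChordDiagram (n + 1)) (Δ' : ChordDiagram n) : Prop where
  ne : ∀ k : Fin (2 * (n + 1)), (k : ℕ) = 2 * n → (Δ.partner k : ℕ) ≠ 2 * n + 1
  eq_of_lt : ∀ (i : Fin (2 * n)) (k : Fin (2 * (n + 1))), (k : ℕ) = i →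
    (Δ.partner k : ℕ) < 2 * n → (Δ'.partner i : ℕ) = Δ.partner k
  eq_of_penultimate : ∀ (i : Fin (2 * n)) (k l : Fin (2 * (n + 1))), (k : ℕ) = i →
    (Δ.partner k : ℕ) = 2 * n → (l : ℕ) = 2 * n + 1 → (Δ'.partner i : ℕ) = Δ.partner l
  eq_of_last : ∀ (i : Fin (2 * n)) (k l : Fin (2 * (n + 1))), (k : ℕ) = i →
    (Δ.partner k : ℕ) = 2 * n + 1 → (l : ℕ) = 2 * n → (Δ'.partner i : ℕ) = Δ.partner l

/-- The new bottom chord joins 0 to the last point, and these are glued to the last and the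
penultimate top points. Hence it acts as a cap on the last two points of `Δ`. The renumbering
`minusEmb` makes the remaining gluing agree with the shift on fewer points. -/
theorem pairing_createMinus_of_cap {n : ℕ} (Γ : ChordDiagram (n + 1))
    {Δ : ChordDiagram (n + 1 + 1)} {Δ' : ChordDiagram (n + 1)} (h : IsCap Δ Δ') :
    pairing (createMinus Γ) Δ = pairing Γ Δ' := by
  have rot : ∀ (u : Fin (2 * (n + 1))) (k : Fin (2 * (n + 1 + 1))), (k : ℕ) = u →
      finRotate _ k = minusEmb (finRotate _ u) := by
    intro u k hk
    have := finRotate_val u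
    have := finRotate_val k
    have := minusEmb_val (finRotate _ u)
    ext; omega
  have rotp : ∀ k : Fin (2 * (n + 1 + 1)), (k : ℕ) = 2 * (n + 1) →
      finRotate _ k = ⟨2 * (n + 1) + 1, by omega⟩ := by
    intro k hk
    have := finRotate_val k
    ext; simp only; omega
  have rotl : ∀ k : Fin (2 * (n + 1 + 1)), (k : ℕ) = 2 * (n + 1) + 1 →
      finRotate _ k = ⟨0, by omega⟩ := by
    intro k hk
    have := finRotate_val k
    ext; simp only; omega
  have hi : ∀ w : Fin (2 * (n + 1)), minusEmb w ≠ ⟨0, by omega⟩ := by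
    intro w hw
    have := minusEmb_val w
    rw [hw] at this
    simp only at this
    omega
  have hj : ∀ w : Fin (2 * (n + 1)), minusEmb w ≠ ⟨2 * (n + 1) + 1, by omega⟩ := by
    intro w hw
    have := minusEmb_val w
    rw [hw] at this
    simp only at this
    omega
  have top : ∀ (u : Fin (2 * (n + 1))) (k : Fin (2 * (n + 1 + 1))), (k : ℕ) = u →
      Δ.topPartner (minusEmb (finRotate _ u)) = finRotate _ (Δ.partner k) := by
    intro u k hk
    rw [← rot u k hk, topPartner_finRotate]
  have top₀ : Δ.topPartner ⟨0, by omega⟩ =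
      finRotate _ (Δ.partner ⟨2 * (n + 1) + 1, by omega⟩) := by
    rw [← topPartner_finRotate, rotl _ rfl]
  have top₁ : Δ.topPartner ⟨2 * (n + 1) + 1, by omega⟩ =
      finRotate _ (Δ.partner ⟨2 * (n + 1), by omega⟩) := by
    rw [← topPartner_finRotate, rotp _ rfl]
  refine transitiveIndicator_congr (IsTransitivePair.eliminate
    (i := ⟨0, by omega⟩) (j := ⟨2 * (n + 1) + 1, by omega⟩) minusEmb minusEmb_injective
    (partner_involutive _) (topPartner_involutive _) ?_ (topPartner_ne _ _) (topPartner_ne _ _)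
    ?_ eq_minusEmb hi hj (fun w => (createMinus_partner_minusEmb Γ w).symm) ?_ ?_ ?_)
  · ext
    rw [createMinus_partner_of_end _ _ (by simp)]
    simp
  · rw [top₀, ← rotp ⟨2 * (n + 1), by omega⟩ rfl]
    intro heq
    have heq := (finRotate _).injective heq
    refine h.ne ⟨2 * (n + 1), by omega⟩ rfl ?_
    rw [← heq, partner_partner, rotp _ rfl]
  -- The three compatibility conditions are settled according to whether the chord of `Δ` at `u`
  -- ends at an uncapped, the penultimate or the last point.
  all_goals
    intro w
    obtain ⟨u, rfl⟩ := (finRotate _).surjective w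
    rw [top u ⟨u, by omega⟩ rfl, topPartner_finRotate]
    have hc : ∀ k : Fin (2 * (n + 1 + 1)), (k : ℕ) < 2 * (n + 1) ∨
        (k : ℕ) = 2 * (n + 1) ∨ (k : ℕ) = 2 * (n + 1) + 1 := fun k => by omega
    rcases hc (Δ.partner ⟨u, by omega⟩) with hu | hu | hu
  · intro _ _
    exact (rot _ _ (h.eq_of_lt u _ rfl hu).symm).symm
  · intro _ h'
    exact absurd (rotp _ hu) h'
  · intro h' _
    exact absurd (rotl _ hu) h'
  · intro h'
    rw [rot ⟨_, hu⟩ _ rfl] at h'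
    exact absurd h' (hi _)
  · intro h'
    rw [rotp _ hu] at h'
    simp [Fin.ext_iff] at h'
  · intro _
    rw [top₁]
    exact (rot _ _ (h.eq_of_last u _ _ rfl hu rfl).symm).symm
  · intro h'
    rw [rot ⟨_, hu⟩ _ rfl] at h'
    exact absurd h' (hj _)
  · intro _
    rw [top₀]
    exact (rot _ _ (h.eq_of_penultimate u _ _ rfl hu rfl).symm).symm
  · intro h'
    rw [rotl _ hu] at h'
    simp [Fin.ext_iff] at h'

/-- Here the cap closes the last top chord into a curve of its own. -/
theorem pairing_createMinus_of_adjacent {n : ℕ} (Γ : ChordDiagram (n + 1))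
    {Δ : ChordDiagram (n + 1 + 1)}
    (h : Δ.partner ⟨2 * (n + 1), by omega⟩ = ⟨2 * (n + 1) + 1, by omega⟩) :
    pairing (createMinus Γ) Δ = 0 := by
  refine transitiveIndicator_eq_zero (IsTransitivePair.not_of_orbit (i := ⟨0, by omega⟩)
    (j := ⟨2 * (n + 1) + 1, by omega⟩) (k := ⟨1, by omega⟩) (partner_involutive _)
    (topPartner_involutive _) ?_ ?_ (by simp) (by simp))
  · ext
    rw [createMinus_partner_of_end _ _ (by simp)]
    simp
  · have e₁ := finRotate_val (⟨2 * (n + 1) + 1, by omega⟩ : Fin (2 * (n + 1 + 1)))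
    have e₂ : finRotate _ (⟨2 * (n + 1) + 1, by omega⟩ : Fin (2 * (n + 1 + 1))) =
        ⟨0, by omega⟩ := by
      ext; simp only at *; omega
    rw [← e₂, topPartner_finRotate, ← h, partner_partner]
    have e₃ := finRotate_val (⟨2 * (n + 1), by omega⟩ : Fin (2 * (n + 1 + 1)))
    rw [h]
    ext; simp only at *; omega

/-- The cap runs from the old base point, now penultimate, to the last point and along the new chord
to 0, so 0 takes back the role of the base point of `Γ`. -/
theorem isCap_createMinus {n : ℕ} (Γ : ChordDiagram (n + 1)) : IsCap (createMinus Γ) Γ := by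
  have hn : ∀ (i : Fin (2 * (n + 1))) (k : Fin (2 * (n + 1 + 1))), (k : ℕ) = i →
      (i : ℕ) ≠ 0 → (createMinus Γ).partner k = minusEmb (Γ.partner i) := by
    intro i k hk hi
    rw [← createMinus_partner_minusEmb]
    congr 1
    have := minusEmb_val i
    ext; omega
  have h₀ : ∀ (i : Fin (2 * (n + 1))) (k : Fin (2 * (n + 1 + 1))), (k : ℕ) = 2 * (n + 1) →
      (i : ℕ) = 0 → (createMinus Γ).partner k = minusEmb (Γ.partner i) := by
    intro i k hk hi
    rw [← createMinus_partner_minusEmb]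
    congr 1
    have := minusEmb_val i
    ext; omega
  constructor
  · intro k hk
    rw [h₀ ⟨0, by omega⟩ k hk rfl]
    have := minusEmb_val (Γ.partner ⟨0, by omega⟩)
    omega
  · intro i k hk hlt
    by_cases hi : (i : ℕ) = 0
    · have := createMinus_partner_of_end Γ k (by omega)
      omega
    · rw [hn i k hk hi] at hlt ⊢
      have := minusEmb_val (Γ.partner i)
      omega
  · intro i k l hk hp hl
    have := createMinus_partner_of_end Γ l (by omega)
    by_cases hi : (i : ℕ) = 0
    · have := createMinus_partner_of_end Γ k (by omega)
      omega
    · rw [hn i k hk hi] at hp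
      have := minusEmb_val (Γ.partner i)
      omega
  · intro i k l hk hp hl
    by_cases hi : (i : ℕ) = 0
    · rw [h₀ i l hl hi]
      have := minusEmb_val (Γ.partner i)
      have : (Γ.partner i : ℕ) ≠ i := fun h => Γ.partner_ne i (Fin.ext h)
      omega
    · rw [hn i k hk hi] at hp
      have := minusEmb_val (Γ.partner i)
      omega

/-- Capping happens at the last two points and the new chord sits at the first two, so the
operations commute. -/
theorem IsCap.createPlus {n : ℕ} {Δ : ChordDiagram (n + 1)} {Δ' : ChordDiagram n}
    (h : IsCap Δ Δ') : IsCap (createPlus Δ) (createPlus Δ') := by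
  have hs : ∀ k : Fin (2 * (n + 1 + 1)), (hk : 2 ≤ (k : ℕ)) →
      ((ChordDiagram.createPlus Δ).partner k : ℕ) = Δ.partner ⟨k - 2, by omega⟩ + 2 :=
    fun k hk => createPlus_partner_val Δ _ k (by simp only; omega)
  have hs' : ∀ k : Fin (2 * (n + 1)), (hk : 2 ≤ (k : ℕ)) →
      ((ChordDiagram.createPlus Δ').partner k : ℕ) = Δ'.partner ⟨k - 2, by omega⟩ + 2 :=
    fun k hk => createPlus_partner_val Δ' _ k (by simp only; omega)
  constructor
  · intro k hk
    have := h.ne ⟨k - 2, by omega⟩ (by simp only; omega)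
    have := hs k (by omega)
    omega
  · intro i k hk hlt
    by_cases hi : (i : ℕ) < 2
    · have := createPlus_partner_of_lt Δ k (by omega)
      have := createPlus_partner_of_lt Δ' i hi
      omega
    · have e₁ := hs k (by omega)
      have e₂ := hs' i (by omega)
      have := h.eq_of_lt ⟨i - 2, by omega⟩ ⟨k - 2, by omega⟩ (by simp only; omega) (by omega)
      omega
  · intro i k l hk hp hl
    by_cases hi : (i : ℕ) < 2
    · have := createPlus_partner_of_lt Δ k (by omega)
      omega
    · have e₁ := hs k (by omega)
      have e₂ := hs' i (by omega)
      have e₃ := hs l (by omega)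
      have := h.eq_of_penultimate ⟨i - 2, by omega⟩ ⟨k - 2, by omega⟩ ⟨l - 2, by omega⟩
        (by simp only; omega) (by omega) (by simp only; omega)
      omega
  · intro i k l hk hp hl
    by_cases hi : (i : ℕ) < 2
    · have := createPlus_partner_of_lt Δ k (by omega)
      omega
    · have e₁ := hs k (by omega)
      have e₂ := hs' i (by omega)
      have e₃ := hs l (by omega)
      have := h.eq_of_last ⟨i - 2, by omega⟩ ⟨k - 2, by omega⟩ ⟨l - 2, by omega⟩
        (by simp only; omega) (by omega) (by simp only; omega)
      omega

end ChordDiagram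

/-! ### The order on words through prefix counts -/

/-- The number of minus signs among the first `k` letters of a word. -/
def minusCount {n : ℕ} (k : ℕ) (w : Fin n → Bool) : ℕ :=
  ((minusPositions w).filter fun i : Fin n => (i : ℕ) < k).card

theorem minusCount_zero {n : ℕ} (w : Fin n → Bool) : minusCount 0 w = 0 := by
  simp [minusCount]

theorem minusCount_eq_sum {n : ℕ} (k : ℕ) (w : Fin n → Bool) :
    minusCount k w = ∑ i : Fin n, if w i = false ∧ (i : ℕ) < k then 1 else 0 := by
  rw [minusCount, minusPositions, Finset.filter_filter, Finset.card_filter]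

theorem minusCount_succ {n : ℕ} (k : ℕ) (w : Fin (n + 1) → Bool) :
    minusCount (k + 1) w = (if w 0 then 0 else 1) + minusCount k (Fin.tail w) := by
  rw [minusCount_eq_sum, minusCount_eq_sum, Fin.sum_univ_succ]
  congr 1
  · cases w 0 <;> simp
  · refine Finset.sum_congr rfl fun i _ => if_congr ?_ rfl rfl
    simp [Fin.tail]

theorem minusCount_length {n : ℕ} (w : Fin n → Bool) :
    minusCount n w = (minusPositions w).card := by
  rw [minusCount, Finset.filter_true_of_mem]
  exact fun i _ => i.2

theorem minusCount_eq_card_filter {n c : ℕ} (w : Fin n → Bool) (h : (minusPositions w).card = c)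
    (k : ℕ) : minusCount k w =
      (Finset.univ.filter fun i : Fin c => ((minusPositions w).orderEmbOfFin h i : ℕ) < k).card := by
  rw [minusCount]
  conv_lhs => rw [← Finset.map_orderEmbOfFin_univ (minusPositions w) h]
  rw [Finset.filter_map, Finset.card_map]
  rfl

/-- Moving minus signs to the left increases the count in every prefix. Unlike positions of minus
signs, prefix counts behave simply when a letter is removed. -/
theorem wordLE_iff_minusCount {n : ℕ} (w₁ w₂ : Fin n → Bool) : WordLE w₁ w₂ ↔
    minusCount n w₁ = minusCount n w₂ ∧ ∀ k, minusCount k w₂ ≤ minusCount k w₁ := by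
  rw [minusCount_length, minusCount_length]
  constructor
  · rintro ⟨h, hle⟩
    refine ⟨h, fun k => ?_⟩
    rw [minusCount_eq_card_filter w₂ rfl, minusCount_eq_card_filter w₁ h]
    refine Finset.card_le_card fun i hi => ?_
    have h₁ := hle i
    rw [Fin.le_def] at h₁
    simp only [Finset.mem_filter, Finset.mem_univ, true_and] at hi ⊢
    omega
  · rintro ⟨h, hle⟩
    refine ⟨h, fun i => ?_⟩
    by_contra! hlt
    -- The prefix ending just after the `i`-th minus sign of `w₂` contains at least `i + 1` minus
    -- signs of `w₂` but at most `i` of `w₁` (counting `i` from 0).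
    have h₁ := hle ((minusPositions w₂).orderEmbOfFin rfl i + 1)
    rw [minusCount_eq_card_filter w₂ rfl, minusCount_eq_card_filter w₁ h] at h₁
    have h₂ : (Finset.univ.filter fun j => ((minusPositions w₁).orderEmbOfFin h j : ℕ) <
        (minusPositions w₂).orderEmbOfFin rfl i + 1) ⊆ Finset.Iio i := by
      intro j hj
      simp only [Finset.mem_filter, Finset.mem_univ, true_and] at hj
      rw [Finset.mem_Iio]
      by_contra! hij
      have := ((minusPositions w₁).orderEmbOfFin h).monotone hij
      rw [Fin.le_def] at this
      rw [Fin.lt_def] at hlt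
      omega
    have h₃ : Finset.Iic i ⊆ (Finset.univ.filter fun j =>
        ((minusPositions w₂).orderEmbOfFin rfl j : ℕ) <
          (minusPositions w₂).orderEmbOfFin rfl i + 1) := by
      intro j hj
      have := ((minusPositions w₂).orderEmbOfFin rfl).monotone (Finset.mem_Iic.1 hj)
      rw [Fin.le_def] at this
      simp only [Finset.mem_filter, Finset.mem_univ, true_and]
      omega
    have h₄ := Finset.card_le_card h₂
    have h₅ := Finset.card_le_card h₃
    rw [Fin.card_Iio] at h₄
    rw [Fin.card_Iic] at h₅
    omega

theorem WordLE.refl {n : ℕ} (w : Fin n → Bool) : WordLE w w := ⟨rfl, fun _ => le_rfl⟩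

theorem WordLE.trans {n : ℕ} {w₁ w₂ w₃ : Fin n → Bool} (h : WordLE w₁ w₂) (h' : WordLE w₂ w₃) :
    WordLE w₁ w₃ := by
  rw [wordLE_iff_minusCount] at *
  exact ⟨h.1.trans h'.1, fun k => (h'.2 k).trans (h.2 k)⟩

theorem eq_of_minusCount_eq {n : ℕ} {w₁ w₂ : Fin n → Bool}
    (h : ∀ k, minusCount k w₁ = minusCount k w₂) : w₁ = w₂ := by
  induction n with
  | zero => exact Subsingleton.elim _ _
  | succ n ih =>
    have h₀ : w₁ 0 = w₂ 0 := by
      have := h 1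
      rw [minusCount_succ, minusCount_succ, minusCount_zero, minusCount_zero] at this
      cases h₁ : w₁ 0 <;> cases h₂ : w₂ 0 <;> simp_all
    have ht : Fin.tail w₁ = Fin.tail w₂ := ih fun k => by
      have := h (k + 1)
      rwa [minusCount_succ, minusCount_succ, h₀, Nat.add_left_cancel_iff] at this
    rw [← Fin.cons_self_tail w₁, ← Fin.cons_self_tail w₂, h₀, ht]

theorem WordLE.antisymm {n : ℕ} {w₁ w₂ : Fin n → Bool} (h : WordLE w₁ w₂) (h' : WordLE w₂ w₁) :
    w₁ = w₂ := by
  rw [wordLE_iff_minusCount] at *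
  exact eq_of_minusCount_eq fun k => (h'.2 k).antisymm (h.2 k)

/-! ### The pairing of basis diagrams -/

namespace ChordDiagram

theorem ofWord_of_plus {n : ℕ} {w : Fin (n + 1) → Bool} (h : w 0 = true) :
    ofWord w = createPlus (ofWord (Fin.tail w)) := by
  simp [ofWord, h]

theorem ofWord_of_minus {n : ℕ} {w : Fin (n + 1) → Bool} (h : w 0 = false) :
    ofWord w = createMinus (ofWord (Fin.tail w)) := by
  simp [ofWord, h]

theorem isCap_ofWord_of_minus {n : ℕ} {w : Fin (n + 1) → Bool} (h : w 0 = false) :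
    IsCap (ofWord w) (ofWord (Fin.tail w)) ∧
      ∀ k, minusCount (k + 1) w = minusCount k (Fin.tail w) + 1 := by
  refine ⟨?_, fun k => ?_⟩
  · rw [ofWord_of_minus h]
    exact isCap_createMinus _
  · rw [minusCount_succ, h]
    simp [add_comm]

/-- Joining the last two marked points of a basis chord diagram deletes the first minus sign. -/
theorem exists_isCap_ofWord {n : ℕ} (w : Fin (n + 1) → Bool) :
    ((∀ k, minusCount k w = 0) ∧
      (ofWord w).partner ⟨2 * (n + 1), by omega⟩ = ⟨2 * (n + 1) + 1, by omega⟩) ∨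
    ∃ (w' : Fin n → Bool) (p : ℕ), p ≤ n ∧ IsCap (ofWord w) (ofWord w') ∧
      (∀ k ≤ p, minusCount k w = 0 ∧ minusCount k w' = 0) ∧
      ∀ k, p ≤ k → minusCount (k + 1) w = minusCount k w' + 1 := by
  by_cases h₀ : w 0 = false
  · obtain ⟨h₁, h₂⟩ := isCap_ofWord_of_minus h₀
    -- The number `p` is the length of the run of plus signs before the first minus sign: 0 here,
    -- and one more for each leading plus sign.
    refine Or.inr ⟨Fin.tail w, 0, Nat.zero_le _, h₁, fun k hk => ?_, fun k _ => h₂ k⟩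
    rw [Nat.le_zero.1 hk, minusCount_zero, minusCount_zero]
    exact ⟨rfl, rfl⟩
  · rw [Bool.not_eq_false] at h₀
    have hs : ∀ k, minusCount (k + 1) w = minusCount k (Fin.tail w) := fun k => by
      rw [minusCount_succ, h₀]; simp
    rw [ofWord_of_plus h₀]
    cases n with
    | zero =>
      -- With plus signs only, the vacuum chord ends up on the last two points.
      left
      constructor
      · intro k
        cases k with
        | zero => exact minusCount_zero _
        | succ k =>
          rw [hs, minusCount, Finset.card_eq_zero, Finset.eq_empty_iff_forall_notMem]
          exact fun i => i.elim0
      · ext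
        rw [createPlus_partner_val (ofWord (Fin.tail w)) ⟨0, by omega⟩ _ rfl]
        rfl
    | succ n =>
      rcases exists_isCap_ofWord (Fin.tail w) with ⟨hc, hp⟩ | ⟨w', p, hpn, hcap, h₁, h₂⟩
      · left
        constructor
        · intro k
          cases k with
          | zero => exact minusCount_zero _
          | succ k => rw [hs, hc]
        · ext
          rw [createPlus_partner_val _ ⟨2 * (n + 1), by omega⟩ _ rfl, hp]
          simp only
          omega
      · refine Or.inr ⟨Fin.cons true w', p + 1, by omega, ?_, ?_, ?_⟩
        · rw [ofWord_of_plus (w := Fin.cons true w') rfl, Fin.tail_cons]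
          exact hcap.createPlus
        · intro k hk
          cases k with
          | zero => exact ⟨minusCount_zero _, minusCount_zero _⟩
          | succ k =>
            rw [hs, minusCount_succ, Fin.tail_cons]
            simpa using h₁ k (by omega)
        · intro k hk
          obtain ⟨k, rfl⟩ : ∃ l, k = l + 1 := ⟨k - 1, by omega⟩
          rw [hs, h₂ k (by omega), minusCount_succ, Fin.tail_cons]
          simp

theorem pairing_vacuum : pairing vacuum vacuum = 1 := by
  refine if_pos fun x h _ u v => ?_
  have h₀ : vacuum.partner 0 = 1 := rfl
  have := h 0
  rw [h₀] at this
  change Fin 2 at u v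
  fin_cases u <;> fin_cases v
  exacts [Iff.rfl, this.symm, this, Iff.rfl]

-- Each geometric reduction has its counterpart for words. A common leading plus sign does not
-- affect the order. If `w₀` begins with minus, its first minus sign lies weakly to the left of the
-- first one of `w₁`, so both can be deleted before comparing.
open Classical in
theorem pairing_ofWord {n : ℕ} (w₀ w₁ : Fin n → Bool) :
    pairing (ofWord w₀) (ofWord w₁) = if WordLE w₀ w₁ then 1 else 0 := by
  induction n with
  | zero =>
    rw [if_pos (by rw [Subsingleton.elim w₀ w₁]; exact WordLE.refl _)]
    exact pairing_vacuum
  | succ n ih =>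
    cases h₀ : w₀ 0 with
    | true =>
      rw [ofWord_of_plus h₀]
      cases h₁ : w₁ 0 with
      | true =>
        rw [ofWord_of_plus h₁, pairing_createPlus_createPlus, ih]
        refine if_congr ?_ rfl rfl
        simp only [wordLE_iff_minusCount]
        rw [minusCount_succ, minusCount_succ, h₀, h₁]
        refine and_congr (by simp) ⟨fun h k => ?_, fun h k => ?_⟩
        · cases k with
          | zero => simp [minusCount_zero]
          | succ k =>
            rw [minusCount_succ, minusCount_succ, h₀, h₁]
            simpa using h k
        · have := h (k + 1)
          rw [minusCount_succ, minusCount_succ, h₀, h₁] at this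
          simpa using this
      | false =>
        -- The prefix of length one already violates the order.
        rw [ofWord_of_minus h₁, pairing_createPlus_createMinus, if_neg]
        rw [wordLE_iff_minusCount]
        rintro ⟨-, h⟩
        have := h 1
        rw [minusCount_succ, minusCount_succ, h₀, h₁, minusCount_zero, minusCount_zero] at this
        simp at this
    | false =>
      have hs := (isCap_ofWord_of_minus h₀).2
      rw [ofWord_of_minus h₀]
      rcases exists_isCap_ofWord w₁ with ⟨hc, hp⟩ | ⟨w', p, hpn, hcap, h₁, h₂⟩
      · rw [pairing_createMinus_of_adjacent _ hp, if_neg]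
        rw [wordLE_iff_minusCount, hs, hc]
        omega
      · rw [pairing_createMinus_of_cap _ hcap, ih]
        refine if_congr ?_ rfl rfl
        simp only [wordLE_iff_minusCount]
        rw [hs, h₂ n hpn]
        refine and_congr (by omega) ⟨fun h k => ?_, fun h k => ?_⟩
        -- Prefixes of `w₁` that stop before its first minus sign impose no condition.
        · rcases Nat.lt_or_ge p k with hk | hk
          · obtain ⟨k, rfl⟩ : ∃ l, k = l + 1 := ⟨k - 1, by omega⟩
            have := h k
            rw [hs, h₂ k (by omega)]
            omega
          · rw [(h₁ k hk).1]
            exact Nat.zero_le _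
        · rcases Nat.lt_or_ge k p with hk | hk
          · rw [(h₁ k hk.le).2]
            exact Nat.zero_le _
          · have := h (k + 1)
            rw [hs, h₂ k hk] at this
            omega

end ChordDiagram

namespace ChordDiagram

/-! ### Creation operators and bypass relations -/

theorem IsBypassTriple.createPlus {n : ℕ} {Γ₁ Γ₂ Γ₃ : ChordDiagram n}
    (h : IsBypassTriple Γ₁ Γ₂ Γ₃) :
    IsBypassTriple (createPlus Γ₁) (createPlus Γ₂) (createPlus Γ₃) := by
  obtain ⟨a, ha, ⟨h₁, h₂, h₃⟩, ⟨h₄, h₅, h₆⟩, ⟨h₇, h₈, h₉⟩, hout⟩ := h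
  let f : Fin (2 * n) → Fin (2 * (n + 1)) := fun i => ⟨i + 2, by omega⟩
  have hf : ∀ (Γ : ChordDiagram n) {i j}, Γ.partner i = j →
      (ChordDiagram.createPlus Γ).partner (f i) = f j := fun Γ i j h => by
    ext; rw [createPlus_partner_val Γ i _ rfl, h]
  refine ⟨f ∘ a, fun i j hij => ?_, ⟨hf _ h₁, hf _ h₂, hf _ h₃⟩, ⟨hf _ h₄, hf _ h₅, hf _ h₆⟩,
    ⟨hf _ h₇, hf _ h₈, hf _ h₉⟩, fun v hv => ?_⟩
  · have := ha hij
    simp only [f, Function.comp_apply, Fin.lt_def] at this ⊢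
    omega
  · by_cases hlt : (v : ℕ) < 2
    · constructor <;> ext <;> simp only [createPlus_partner_of_lt _ v hlt]
    · obtain ⟨w, rfl⟩ : ∃ w, f w = v := ⟨⟨v - 2, by omega⟩, Fin.ext (by simp only [f]; omega)⟩
      obtain ⟨e₁, e₂⟩ := hout w fun k hk => hv k (by rw [hk]; rfl)
      rw [hf _ rfl, hf _ rfl, hf _ rfl, e₁, e₂]
      exact ⟨rfl, rfl⟩

/-- The old base point moves behind all other old points, so `minusEmb` preserves only the cyclic
order. If the base point is one of the six points, they are renumbered and the triple is permuted
cyclically; the relation in `SFH` does not see this. -/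
theorem createMinus_toSFH_bypass {n : ℕ} {Γ₁ Γ₂ Γ₃ : ChordDiagram n}
    (h : IsBypassTriple Γ₁ Γ₂ Γ₃) :
    (createMinus Γ₁).toSFH + (createMinus Γ₂).toSFH + (createMinus Γ₃).toSFH = 0 := by
  obtain ⟨a, ha, ⟨h₁, h₂, h₃⟩, ⟨h₄, h₅, h₆⟩, ⟨h₇, h₈, h₉⟩, hout⟩ := h
  have hf : ∀ (Γ : ChordDiagram n) {i j}, Γ.partner i = j →
      (createMinus Γ).partner (minusEmb i) = minusEmb j := fun Γ i j h => by
    rw [createMinus_partner_minusEmb, h]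
  have flip : ∀ (Γ : ChordDiagram n) {i j}, Γ.partner i = j → Γ.partner j = i :=
    fun Γ i j h => by rw [← h, Γ.partner_partner]
  have hout' : ∀ v, (∀ k, v ≠ minusEmb (a k)) →
      (createMinus Γ₁).partner v = (createMinus Γ₂).partner v ∧
      (createMinus Γ₂).partner v = (createMinus Γ₃).partner v := by
    intro v hv
    by_cases hend : (v : ℕ) = 0 ∨ (v : ℕ) = 2 * n + 1
    · constructor <;> ext <;> simp only [createMinus_partner_of_end _ v hend]
    · obtain ⟨w, rfl⟩ : ∃ w, minusEmb w = v := by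
        rcases eq_minusEmb v with rfl | rfl | h
        · simp at hend
        · simp at hend
        · exact h
      obtain ⟨e₁, e₂⟩ := hout w fun k hk => hv k (by rw [hk])
      rw [hf _ rfl, hf _ rfl, hf _ rfl, e₁, e₂]
      exact ⟨rfl, rfl⟩
  by_cases h₀ : (a 0 : ℕ) = 0
  -- The numbering now starts at `a 1`, and `a 0` comes last.
  · have key : IsBypassTriple (createMinus Γ₂) (createMinus Γ₃) (createMinus Γ₁) := by
      refine ⟨fun i => minusEmb (a (finRotate 6 i)), Fin.strictMono_iff_lt_succ.2 fun i => ?_,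
        ⟨hf _ h₄, hf _ (flip _ h₅), hf _ h₆⟩, ⟨hf _ h₇, hf _ h₈, hf _ h₉⟩,
        ⟨hf _ h₃, hf _ h₂, hf _ h₁⟩, fun v hv => ?_⟩
      · have hlt : finRotate 6 i.castSucc ≠ 0 ∧ (finRotate 6 i.succ = 0 ∨
            finRotate 6 i.castSucc < finRotate 6 i.succ) := by
          revert i; decide
        have e₁ := ha (Fin.pos_of_ne_zero hlt.1)
        have e₂ := minusEmb_val (a (finRotate 6 i.castSucc))
        have e₃ := minusEmb_val (a (finRotate 6 i.succ))
        rcases hlt.2 with h | h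
        · rw [h] at e₃ ⊢
          rw [Fin.lt_def] at e₁ ⊢
          omega
        · have e₄ := ha h
          rw [Fin.lt_def] at e₁ e₄ ⊢
          omega
      · obtain ⟨e₁, e₂⟩ := hout' v fun k => by
          have := hv ((finRotate 6).symm k)
          simpa only [Equiv.apply_symm_apply] using this
        exact ⟨e₂, e₂.symm.trans e₁.symm⟩
    rw [← toSFH_bypass key]
    abel
  · refine toSFH_bypass ⟨fun i => minusEmb (a i), fun i j hij => ?_, ⟨hf _ h₁, hf _ h₂, hf _ h₃⟩,
      ⟨hf _ h₄, hf _ h₅, hf _ h₆⟩, ⟨hf _ h₇, hf _ h₈, hf _ h₉⟩, hout'⟩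
    have e₁ := ha hij
    have e₂ := ha.monotone (Fin.zero_le i)
    have e₃ := minusEmb_val (a i)
    have e₄ := minusEmb_val (a j)
    rw [Fin.lt_def] at e₁ ⊢
    rw [Fin.le_def] at e₂
    simp only
    omega

theorem exists_createPlus_eq {n : ℕ} (Γ : ChordDiagram (n + 1))
    (h : Γ.partner ⟨0, by omega⟩ = ⟨1, by omega⟩) : ∃ Γ', createPlus Γ' = Γ := by
  have h' : Γ.partner ⟨1, by omega⟩ = ⟨0, by omega⟩ := by rw [← h, partner_partner]
  have hge : ∀ k : Fin (2 * (n + 1)), 2 ≤ (k : ℕ) → 2 ≤ (Γ.partner k : ℕ) := by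
    intro k hk
    by_contra hlt
    have hc : (Γ.partner k : ℕ) = 0 ∨ (Γ.partner k : ℕ) = 1 := by omega
    rcases hc with hc | hc
    · have e : Γ.partner k = ⟨0, by omega⟩ := Fin.ext hc
      have := congrArg Γ.partner e
      rw [partner_partner, h] at this
      rw [this] at hk
      simp at hk
    · have e : Γ.partner k = ⟨1, by omega⟩ := Fin.ext hc
      have := congrArg Γ.partner e
      rw [partner_partner, h'] at this
      rw [this] at hk
      simp at hk
  let f : Fin (2 * n) → Fin (2 * (n + 1)) := fun i => ⟨i + 2, by omega⟩
  let g : Fin (2 * n) → Fin (2 * n) := fun i =>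
    ⟨Γ.partner (f i) - 2, by have := hge (f i) (by simp [f]); omega⟩
  have hg : ∀ i, f (g i) = Γ.partner (f i) := fun i => by
    have := hge (f i) (by simp [f])
    ext
    simp only [f, g] at *
    omega
  have hlt : ∀ {i j}, f i < f j ↔ i < j := fun {i j} => by
    rw [Fin.lt_def, Fin.lt_def]; simp only [f]; omega
  have hinj : ∀ {i j}, f i = f j → i = j := fun {i j} hij => by
    simpa [f, Fin.ext_iff] using hij
  refine ⟨⟨g, fun i => hinj ?_, fun i hi => ?_, fun i j hij => ?_⟩, ?_⟩
  · rw [hg, hg, partner_partner]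
  · refine Γ.partner_ne (f i) ?_
    rw [← hg, hi]
  · refine Γ.noncrossing (f i) (f j) ?_
    rw [← hg, ← hg, hlt, hlt, hlt]
    exact hij
  · ext k
    by_cases hk : (k : ℕ) < 2
    · rw [createPlus_partner_of_lt _ _ hk]
      by_cases hk₀ : (k : ℕ) = 0
      · rw [show k = ⟨0, by omega⟩ from Fin.ext hk₀, h]
        simp
      · rw [show k = ⟨1, by omega⟩ from Fin.ext (by simp only; omega), h']
        simp
    · have e : f ⟨k - 2, by omega⟩ = k := Fin.ext (by simp only [f]; omega)
      rw [createPlus_partner_val _ ⟨k - 2, by omega⟩ k (by simp only; omega)]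
      have := congrArg Fin.val (hg ⟨k - 2, by omega⟩)
      rw [e] at this
      exact this

theorem exists_createMinus_eq {n : ℕ} (Γ : ChordDiagram (n + 1))
    (h : Γ.partner ⟨0, by omega⟩ = ⟨2 * n + 1, by omega⟩) : ∃ Γ', createMinus Γ' = Γ := by
  have h' : Γ.partner ⟨2 * n + 1, by omega⟩ = ⟨0, by omega⟩ := by rw [← h, partner_partner]
  have hex : ∀ i : Fin (2 * n), ∃ j, minusEmb j = Γ.partner (minusEmb i) := by
    intro i
    have hv := minusEmb_val i
    rcases eq_minusEmb (Γ.partner (minusEmb i)) with e | e | e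
    · have := congrArg Γ.partner e
      rw [partner_partner, h] at this
      rw [this] at hv
      simp only at hv
      omega
    · have := congrArg Γ.partner e
      rw [partner_partner, h'] at this
      rw [this] at hv
      simp only at hv
      omega
    · exact e
  choose g hg using hex
  refine ⟨⟨g, fun i => minusEmb_injective ?_, fun i hi => ?_, fun i j hij => ?_⟩, ?_⟩
  · rw [hg, hg, partner_partner]
  · refine Γ.partner_ne (minusEmb i) ?_
    rw [← hg, hi]
  · have c := Γ.noncrossing (minusEmb i) (minusEmb j)
    -- If `i` is the base point, it moves to the end, and the same crossing is then detected
    -- starting from `j`.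
    have c' := Γ.noncrossing (minusEmb j) (minusEmb (g i))
    rw [← hg, ← hg] at c
    rw [← hg, hg i, partner_partner] at c'
    have e₁ := minusEmb_val i
    have e₂ := minusEmb_val j
    have e₃ := minusEmb_val (g i)
    have e₄ := minusEmb_val (g j)
    rw [← hg i] at c'
    simp only [Fin.lt_def] at c c' hij
    omega
  · refine ChordDiagram.ext (funext fun k => ?_)
    rcases eq_minusEmb k with rfl | rfl | ⟨i, rfl⟩
    · ext
      rw [createMinus_partner_of_end _ _ (by simp), h]
      simp
    · ext
      rw [createMinus_partner_of_end _ _ (by simp), h']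
      simp
    · rw [createMinus_partner_minusEmb]
      exact hg i

/-! ### Rewiring -/

/-- A chord separates the other chords into two classes. -/
theorem between_iff {n : ℕ} (Γ : ChordDiagram n) {u i : Fin (2 * n)}
    (hi : i ≠ u) (hi' : i ≠ Γ.partner u) :
    (u < i ∧ i < Γ.partner u) ↔ (u < Γ.partner i ∧ Γ.partner i < Γ.partner u) := by
  have key : ∀ i, i ≠ u → i ≠ Γ.partner u → (u < i ∧ i < Γ.partner u) →
      (u < Γ.partner i ∧ Γ.partner i < Γ.partner u) := by
    intro i hi hi' h
    have h₁ := Γ.noncrossing u i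
    have h₂ := Γ.noncrossing (Γ.partner i) u
    rw [partner_partner] at h₂
    have h₃ : Γ.partner i ≠ u := fun e => hi' (by rw [← e, partner_partner])
    have h₄ : Γ.partner i ≠ Γ.partner u := fun e => hi (Γ.partner_involutive.injective e)
    rw [Ne, Fin.ext_iff] at h₃ h₄
    simp only [Fin.lt_def] at *
    omega
  refine ⟨key i hi hi', fun h => ?_⟩
  have := key (Γ.partner i) (fun e => hi' (by rw [← e, partner_partner]))
    (fun e => hi (Γ.partner_involutive.injective e)) h
  rwa [partner_partner] at this

/-- The chords that end at the points `a 0 < a 1 < ⋯` can be replaced by any noncrossing chords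
with the same ends when no other chord separates these points. -/
theorem exists_rewiring {n r : ℕ} (Γ : ChordDiagram n) (a : Fin r → Fin (2 * n))
    (ha : StrictMono a) (hclosed : ∀ m, Γ.partner (a m) ∈ Set.range a)
    (hgap : ∀ i, i ∉ Set.range a → ∀ m, i < a m ↔ Γ.partner i < a m)
    (τ : Fin r → Fin r) (hτ : ∀ m, τ (τ m) = m) (hτne : ∀ m, τ m ≠ m)
    (hτnc : ∀ l m, ¬ (l < m ∧ m < τ l ∧ τ l < τ m)) :
    ∃ Γ' : ChordDiagram n, (∀ m, Γ'.partner (a m) = a (τ m)) ∧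
      ∀ i, i ∉ Set.range a → Γ'.partner i = Γ.partner i := by
  classical
  let f : Fin (2 * n) → Fin (2 * n) := fun i =>
    if h : ∃ m, a m = i then a (τ h.choose) else Γ.partner i
  have hfa : ∀ m, f (a m) = a (τ m) := by
    intro m
    have h : ∃ l, a l = a m := ⟨m, rfl⟩
    simp only [f, dif_pos h]
    rw [ha.injective h.choose_spec]
  have hfo : ∀ i, i ∉ Set.range a → f i = Γ.partner i := fun i hi => dif_neg hi
  have hout : ∀ i, i ∉ Set.range a → Γ.partner i ∉ Set.range a := by
    rintro i hi ⟨m, hm⟩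
    refine hi ?_
    have := hclosed m
    rwa [hm, partner_partner] at this
  refine ⟨⟨f, fun i => ?_, fun i => ?_, fun i j => ?_⟩, hfa, hfo⟩
  · by_cases hi : i ∈ Set.range a
    · obtain ⟨m, rfl⟩ := hi
      rw [hfa, hfa, hτ]
    · rw [hfo i hi, hfo _ (hout i hi), partner_partner]
  · by_cases hi : i ∈ Set.range a
    · obtain ⟨m, rfl⟩ := hi
      rw [hfa]
      exact fun h => hτne m (ha.injective h)
    · rw [hfo i hi]
      exact Γ.partner_ne i
  -- By `hgap` an untouched chord has no point `a m` separating its ends, so it cannot cross a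
  -- rewired chord.
  · by_cases hi : i ∈ Set.range a
    · obtain ⟨l, rfl⟩ := hi
      rw [hfa]
      by_cases hj : j ∈ Set.range a
      · obtain ⟨m, rfl⟩ := hj
        rw [hfa, ha.lt_iff_lt, ha.lt_iff_lt, ha.lt_iff_lt]
        exact hτnc l m
      · rw [hfo j hj]
        rintro ⟨-, h₂, h₃⟩
        exact h₃.asymm ((hgap j hj _).1 h₂)
    · rw [hfo i hi]
      by_cases hj : j ∈ Set.range a
      · obtain ⟨m, rfl⟩ := hj
        rintro ⟨h₁, h₂, -⟩
        exact h₂.asymm ((hgap i hi m).1 h₁)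
      · rw [hfo j hj]
        exact Γ.noncrossing i j

/-- A bypass move near the base point expresses a chord diagram through diagrams with an outermost
chord at the base point. -/
theorem exists_createPlus_add_createMinus {n : ℕ} (Γ : ChordDiagram (n + 1))
    (h₁ : Γ.partner ⟨0, by omega⟩ ≠ ⟨1, by omega⟩)
    (h₂ : Γ.partner ⟨0, by omega⟩ ≠ ⟨2 * n + 1, by omega⟩) :
    ∃ Δ Δ' : ChordDiagram n, Γ.toSFH = (createPlus Δ).toSFH + (createMinus Δ').toSFH := by
  obtain ⟨z, hz⟩ : ∃ z : Fin (2 * (n + 1)), z = ⟨0, by omega⟩ := ⟨_, rfl⟩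
  obtain ⟨o, ho⟩ : ∃ o : Fin (2 * (n + 1)), o = ⟨1, by omega⟩ := ⟨_, rfl⟩
  obtain ⟨e, he⟩ : ∃ e : Fin (2 * (n + 1)), e = ⟨2 * n + 1, by omega⟩ := ⟨_, rfl⟩
  rw [← hz, ← ho] at h₁
  rw [← hz, ← he] at h₂
  rw [Fin.ext_iff] at hz ho he
  simp only at hz ho he
  have hzk := Γ.partner_ne z
  have hop := Γ.partner_ne o
  have heq := Γ.partner_ne e
  obtain ⟨k, hk⟩ : ∃ k, k = Γ.partner z := ⟨_, rfl⟩
  obtain ⟨p, hp⟩ : ∃ p, p = Γ.partner o := ⟨_, rfl⟩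
  obtain ⟨q, hq⟩ : ∃ q, q = Γ.partner e := ⟨_, rfl⟩
  have hkz : Γ.partner k = z := by rw [hk, partner_partner]
  have hpo : Γ.partner p = o := by rw [hp, partner_partner]
  have hqe : Γ.partner q = e := by rw [hq, partner_partner]
  have hoz : o ≠ z := fun h => by rw [Fin.ext_iff] at h; omega
  have hez : e ≠ z := fun h => by rw [Fin.ext_iff] at h; omega
  have b₁ := Γ.between_iff (u := z) (i := o) hoz h₁.symm
  have b₂ := Γ.between_iff (u := z) (i := e) hez h₂.symm
  have hpz : p ≠ z := fun h => h₁ (by rw [← h, hpo])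
  have hqz : q ≠ z := fun h => h₂ (by rw [← h, hqe])
  have hqk : q ≠ k := fun h => hez (by rw [← hqe, h, hkz])
  rw [← hk, ← hp] at b₁
  rw [← hk, ← hq] at b₂
  rw [← hk] at h₁ h₂ hzk
  rw [← hp] at hop
  rw [← hq] at heq
  -- The chord from the base point to `k` separates the point 1 from the last point, which places
  -- their partners on its two sides.
  have hord : (1 < (p : ℕ) ∧ p < k) ∧ k < q ∧ (q : ℕ) < 2 * n + 1 := by
    simp only [Ne, Fin.ext_iff, Fin.lt_def] at *
    omega
  obtain ⟨⟨hp₁, hpk⟩, hkq, hqn⟩ := hord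
  -- On these six points `Γ` is the middle diagram of a bypass triple. The other two join the base
  -- point to its two neighbours.
  let a : Fin 6 → Fin (2 * (n + 1)) := ![z, o, p, k, q, e]
  have ha : StrictMono a := by
    have hzo : z < o := by rw [Fin.lt_def]; omega
    have hop : o < p := by rw [Fin.lt_def]; omega
    have hqe : q < e := by rw [Fin.lt_def]; omega
    refine Fin.strictMono_iff_lt_succ.2 fun i => ?_
    fin_cases i
    exacts [hzo, hop, hpk, hkq, hqe]
  have hclosed : ∀ m, Γ.partner (a m) ∈ Set.range a := by
    intro m
    fin_cases m
    exacts [⟨3, hk⟩, ⟨2, hp⟩, ⟨1, hpo.symm⟩, ⟨0, hkz.symm⟩, ⟨5, hqe.symm⟩, ⟨4, hq⟩]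
  have hgap : ∀ i, i ∉ Set.range a → ∀ m, i < a m ↔ Γ.partner i < a m := by
    intro i hi m
    have hne : ∀ m, i ≠ a m := fun m h => hi ⟨m, h.symm⟩
    have hne' : ∀ m, Γ.partner i ≠ a m := fun m h => hi (by
      have := hclosed m
      rwa [← h, partner_partner] at this)
    -- Both ends of any other chord lie on the same side of each of the three chords, hence in the
    -- same gap between consecutive points of `a`.
    have b₃ := Γ.between_iff (u := z) (i := i) (hne 0) (by rw [← hk]; exact hne 3)
    have b₄ := Γ.between_iff (u := o) (i := i) (hne 1) (by rw [← hp]; exact hne 2)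
    have b₅ := Γ.between_iff (u := q) (i := i) (hne 4) (by rw [hqe]; exact hne 5)
    rw [← hk] at b₃
    rw [← hp] at b₄
    rw [hqe] at b₅
    have n₀ : i ≠ z := hne 0
    have n₁ : i ≠ o := hne 1
    have n₅ : i ≠ e := hne 5
    have n₂ : i ≠ p := hne 2
    have n₄ : i ≠ q := hne 4
    have m₀ : Γ.partner i ≠ z := hne' 0
    have m₁ : Γ.partner i ≠ o := hne' 1
    have m₅ : Γ.partner i ≠ e := hne' 5
    have m₄ : Γ.partner i ≠ q := hne' 4
    generalize Γ.partner i = j at *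
    clear hne hne' hclosed ha hi
    simp only [Ne, Fin.ext_iff, Fin.lt_def] at *
    fin_cases m <;> simp [a] <;> omega
  obtain ⟨Γ₁, hΓ₁, hΓ₁o⟩ := Γ.exists_rewiring a ha hclosed hgap (bypassPairing 0) (by decide)
    (by decide) (by decide)
  obtain ⟨Γ₃, hΓ₃, hΓ₃o⟩ := Γ.exists_rewiring a ha hclosed hgap (bypassPairing 2) (by decide)
    (by decide) (by decide)
  have htriple : IsBypassTriple Γ₁ Γ Γ₃ := by
    refine ⟨a, ha, ⟨hΓ₁ 0, hΓ₁ 2, hΓ₁ 3⟩, ⟨hp.symm, hk.symm, hqe⟩, ⟨hΓ₃ 2, hΓ₃ 1, hΓ₃ 5⟩,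
      fun i hi => ?_⟩
    have : i ∉ Set.range a := by
      rintro ⟨m, hm⟩
      exact hi m hm.symm
    rw [hΓ₁o i this, hΓ₃o i this]
    exact ⟨rfl, rfl⟩
  obtain ⟨Δ, rfl⟩ := exists_createPlus_eq Γ₁ (by
    have : Γ₁.partner z = o := hΓ₁ 0
    rwa [show z = ⟨0, by omega⟩ from Fin.ext hz, show o = ⟨1, by omega⟩ from Fin.ext ho] at this)
  obtain ⟨Δ', rfl⟩ := exists_createMinus_eq Γ₃ (by
    have : Γ₃.partner z = e := hΓ₃ 0
    rwa [show z = ⟨0, by omega⟩ from Fin.ext hz,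
      show e = ⟨2 * n + 1, by omega⟩ from Fin.ext he] at this)
  refine ⟨Δ, Δ', ?_⟩
  have := toSFH_bypass htriple
  have h2 : Γ.toSFH + Γ.toSFH = 0 := by
    rw [← two_smul (ZMod 2), show (2 : ZMod 2) = 0 from rfl, zero_smul]
  calc Γ.toSFH = ((createPlus Δ).toSFH + Γ.toSFH + (createMinus Δ').toSFH) + Γ.toSFH := by
        rw [this, zero_add]
    _ = (createPlus Δ).toSFH + (createMinus Δ').toSFH + (Γ.toSFH + Γ.toSFH) := by abel
    _ = _ := by rw [h2, add_zero]

end ChordDiagram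

namespace ChordDiagram

/-! ### The basis decomposition -/

/-- Since creation respects the bypass relations, it induces a linear map on `SFH`; this map
prepends a letter to each basis diagram. -/
theorem createPlus_mem_span {n : ℕ} (Γ : ChordDiagram (n + 1))
    (h : Γ.toSFH ∈ Submodule.span (ZMod 2) (Set.range fun w : Fin n → Bool => (ofWord w).toSFH)) :
    (createPlus Γ).toSFH ∈
      Submodule.span (ZMod 2) (Set.range fun w : Fin (n + 1) → Bool => (ofWord w).toSFH) := by
  let L := liftSFH (fun Δ : ChordDiagram (n + 1) => (createPlus Δ).toSFH)
    fun _ _ _ h => toSFH_bypass h.createPlus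
  have hL : ∀ Δ : ChordDiagram (n + 1), L Δ.toSFH = (createPlus Δ).toSFH := liftSFH_toSFH _ _
  rw [← hL]
  refine (Submodule.map_span_le L _ _).2 ?_ (Submodule.mem_map_of_mem h)
  rintro _ ⟨w, rfl⟩
  refine Submodule.subset_span ⟨Fin.cons true w, ?_⟩
  simp only
  rw [hL, ofWord_of_plus (Fin.cons_zero _ _), Fin.tail_cons]

theorem createMinus_mem_span {n : ℕ} (Γ : ChordDiagram (n + 1))
    (h : Γ.toSFH ∈ Submodule.span (ZMod 2) (Set.range fun w : Fin n → Bool => (ofWord w).toSFH)) :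
    (createMinus Γ).toSFH ∈
      Submodule.span (ZMod 2) (Set.range fun w : Fin (n + 1) → Bool => (ofWord w).toSFH) := by
  let L := liftSFH (fun Δ : ChordDiagram (n + 1) => (createMinus Δ).toSFH)
    fun _ _ _ h => createMinus_toSFH_bypass h
  have hL : ∀ Δ : ChordDiagram (n + 1), L Δ.toSFH = (createMinus Δ).toSFH := liftSFH_toSFH _ _
  rw [← hL]
  refine (Submodule.map_span_le L _ _).2 ?_ (Submodule.mem_map_of_mem h)
  rintro _ ⟨w, rfl⟩
  refine Submodule.subset_span ⟨Fin.cons false w, ?_⟩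
  simp only
  rw [hL, ofWord_of_minus (Fin.cons_zero _ _), Fin.tail_cons]

/-- Induction on the number of chords: either the chord at the base point is outermost and can be
removed, or a bypass relation reduces to two such diagrams. -/
theorem toSFH_mem_span {n : ℕ} (Γ : ChordDiagram (n + 1)) :
    Γ.toSFH ∈ Submodule.span (ZMod 2) (Set.range fun w : Fin n → Bool => (ofWord w).toSFH) := by
  induction n with
  | zero =>
    refine Submodule.subset_span ⟨Fin.elim0, ?_⟩
    refine congrArg toSFH (ChordDiagram.ext (funext fun i => Fin.ext ?_))
    have h₁ : ((ofWord (Fin.elim0 : Fin 0 → Bool)).partner i : ℕ) ≠ i :=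
      fun h => partner_ne _ _ (Fin.ext h)
    have h₂ : (Γ.partner i : ℕ) ≠ i := fun h => partner_ne _ _ (Fin.ext h)
    omega
  | succ n ih =>
    by_cases h₁ : Γ.partner ⟨0, by omega⟩ = ⟨1, by omega⟩
    · obtain ⟨Δ, rfl⟩ := exists_createPlus_eq Γ h₁
      exact createPlus_mem_span Δ (ih Δ)
    by_cases h₂ : Γ.partner ⟨0, by omega⟩ = ⟨2 * (n + 1) + 1, by omega⟩
    · obtain ⟨Δ, rfl⟩ := exists_createMinus_eq Γ h₂
      exact createMinus_mem_span Δ (ih Δ)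
    obtain ⟨Δ, Δ', h⟩ := exists_createPlus_add_createMinus Γ h₁ h₂
    rw [h]
    exact Submodule.add_mem _ (createPlus_mem_span Δ (ih Δ)) (createMinus_mem_span Δ' (ih Δ'))

/-- Pairing with a fixed bottom diagram. -/
noncomputable def pairingRight {n : ℕ} (Γ : ChordDiagram n) : SFH n →ₗ[ZMod 2] ZMod 2 :=
  liftSFH (fun Δ => pairing Γ Δ) fun _ _ _ h => pairing_bypass_right h Γ

theorem pairingRight_toSFH {n : ℕ} (Γ Δ : ChordDiagram n) :
    pairingRight Γ Δ.toSFH = pairing Γ Δ := liftSFH_toSFH _ _ _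

/-- Pairing with a fixed top diagram. -/
noncomputable def pairingLeft {n : ℕ} (Γ : ChordDiagram n) : SFH n →ₗ[ZMod 2] ZMod 2 :=
  liftSFH (fun Δ => pairing Δ Γ) fun _ _ _ h => pairing_bypass_left h Γ

theorem pairingLeft_toSFH {n : ℕ} (Γ Δ : ChordDiagram n) :
    pairingLeft Γ Δ.toSFH = pairing Δ Γ := liftSFH_toSFH _ _ _

/-- By `pairing_ofWord` the Gram matrix is that of a partial order, hence unitriangular. -/
theorem linearIndependent_toSFH_ofWord (n : ℕ) :
    LinearIndependent (ZMod 2) fun w : Fin n → Bool => (ofWord w).toSFH := by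
  classical
  rw [Fintype.linearIndependent_iff]
  intro g hg
  by_contra! hne
  -- The relation is reversed, so that `has_min` yields a maximal word `u` with nonzero coefficient.
  -- Pairing with `ofWord u` as bottom diagram then isolates that coefficient.
  let r : (Fin n → Bool) → (Fin n → Bool) → Prop := fun u v => WordLE v u ∧ v ≠ u
  have : IsTrans _ r := ⟨fun a b c hab hbc => ⟨hbc.1.trans hab.1, fun h => by
    subst h; exact hab.2 (hab.1.antisymm hbc.1)⟩⟩
  have : Std.Irrefl r := ⟨fun a h => h.2 rfl⟩
  obtain ⟨u, hu, hmin⟩ := (Finite.wellFounded_of_trans_of_irrefl r).has_min {w | g w ≠ 0} hne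
  refine hu ?_
  have := congrArg (pairingRight (ofWord u)) hg
  simp only [map_sum, map_smul, map_zero, pairingRight_toSFH, pairing_ofWord] at this
  rw [Finset.sum_eq_single u, if_pos (WordLE.refl u)] at this
  · simpa using this
  · intro v _ hv
    by_cases hle : WordLE u v
    · have : g v = 0 := by
        by_contra hgv
        exact hmin v hgv ⟨hle, hv.symm⟩
      rw [this, zero_smul]
    · rw [if_neg hle, smul_zero]
  · simp

theorem existsUnique_basis_decomposition {n : ℕ} (Γ : ChordDiagram (n + 1)) :
    ∃! S : Finset (Fin n → Bool), Γ.toSFH = ∑ w ∈ S, (ofWord w).toSFH := by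
  classical
  have hsum : ∀ S : Finset (Fin n → Bool), ∑ w ∈ S, (ofWord w).toSFH =
      ∑ w, (if w ∈ S then (1 : ZMod 2) else 0) • (ofWord w).toSFH := fun S => by
    simp [ite_smul, Finset.sum_ite_mem]
  obtain ⟨c, hc⟩ := (Submodule.mem_span_range_iff_exists_fun (ZMod 2)).1 (toSFH_mem_span Γ)
  have h01 : ∀ x : ZMod 2, (if x = 1 then (1 : ZMod 2) else 0) = x := by decide
  -- Over `ZMod 2` a coefficient function is the indicator of the set where it equals 1.
  refine ⟨Finset.univ.filter fun w => c w = 1, ?_, fun S hS => ?_⟩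
  · simp only
    rw [hsum, ← hc]
    simp [h01]
  · have h₁ := Fintype.linearIndependent_iff.1 (linearIndependent_toSFH_ofWord n)
      (fun w => (if w ∈ S then (1 : ZMod 2) else 0) - c w) (by
        simp only [sub_smul, Finset.sum_sub_distrib]
        rw [hc, ← hsum, ← hS, sub_self])
    ext w
    have h₂ := sub_eq_zero.1 (h₁ w)
    rw [Finset.mem_filter, ← h₂]
    by_cases hw : w ∈ S <;> simp [hw]

theorem occurs_iff {n : ℕ} {Γ : ChordDiagram (n + 1)} {S : Finset (Fin n → Bool)}
    (hS : Γ.toSFH = ∑ w ∈ S, (ofWord w).toSFH) (w : Fin n → Bool) : Occurs w Γ ↔ w ∈ S := by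
  constructor
  · rintro ⟨T, hT, hw⟩
    rwa [(existsUnique_basis_decomposition Γ).unique hS hT]
  · exact fun hw => ⟨S, hS, hw⟩

open Classical in
theorem pairing_eq_card {n : ℕ} {Γ₀ Γ₁ : ChordDiagram (n + 1)} {S₀ S₁ : Finset (Fin n → Bool)}
    (h₀ : Γ₀.toSFH = ∑ w ∈ S₀, (ofWord w).toSFH) (h₁ : Γ₁.toSFH = ∑ w ∈ S₁, (ofWord w).toSFH) :
    pairing Γ₀ Γ₁ = (((S₀ ×ˢ S₁).filter fun p => WordLE p.1 p.2).card : ZMod 2) := by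
  rw [← pairingLeft_toSFH, h₀, map_sum, Finset.card_filter, Nat.cast_sum, Finset.sum_product]
  refine Finset.sum_congr rfl fun w₀ _ => ?_
  rw [pairingLeft_toSFH, ← pairingRight_toSFH, h₁, map_sum]
  refine Finset.sum_congr rfl fun w₁ _ => ?_
  rw [pairingRight_toSFH, pairing_ofWord]
  simp

end ChordDiagram

theorem mainTheorem4 (n : ℕ) (e : ℤ) (Γ₀ Γ₁ : ChordDiagram (n + 1))
    (h₀ : Γ₀.eulerClass = e) (h₁ : Γ₁.eulerClass = e) :
    (∀ Γ : ChordDiagram (n + 1), ∃! S : Finset (Fin n → Bool),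
      Γ.toSFH = ∑ w ∈ S, (ChordDiagram.ofWord w).toSFH) ∧
    (Γ₁.IsStackableOn Γ₀ ↔
      Odd {p : (Fin n → Bool) × (Fin n → Bool) |
        WordLE p.1 p.2 ∧ ChordDiagram.Occurs p.1 Γ₀ ∧ ChordDiagram.Occurs p.2 Γ₁}.ncard) := by
  classical
  refine ⟨ChordDiagram.existsUnique_basis_decomposition, ?_⟩
  obtain ⟨S₀, hS₀, -⟩ := ChordDiagram.existsUnique_basis_decomposition Γ₀
  obtain ⟨S₁, hS₁, -⟩ := ChordDiagram.existsUnique_basis_decomposition Γ₁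
  have hset : {p : (Fin n → Bool) × (Fin n → Bool) |
      WordLE p.1 p.2 ∧ ChordDiagram.Occurs p.1 Γ₀ ∧ ChordDiagram.Occurs p.2 Γ₁} =
      ((S₀ ×ˢ S₁).filter fun p => WordLE p.1 p.2 : Finset _) := by
    ext p
    simp only [ChordDiagram.occurs_iff hS₀, ChordDiagram.occurs_iff hS₁, Set.mem_ofPred_eq,
      Finset.coe_filter, Finset.mem_product]
    tauto
  rw [hset, Set.ncard_coe_finset, ChordDiagram.isStackableOn_iff_pairing,
    ChordDiagram.pairing_eq_card hS₀ hS₁, ← ZMod.natCast_eq_one_iff_odd]
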